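/- A (central) hyperplane arrangement $(\mathcal A,V)$ is a finite set $\mathcal A$ of linear hyperplanes in a finite-dimensional complex vector space $V$. Its lattice $L(\mathcal A)$ is the set of all intersections of subsets of $\mathcal A$ (the empty intersection being $V$), ordered by reverse inclusion; its rank $r=r(\mathcal A)$ is the codimension of $T(\mathcal A)=\bigcap_{H\in\mathcal A}H$. An element $X\in L(\mathcal A)$ is modular if $X+Y\in L(\mathcal A)$ for all $Y\in L(\mathcal A)$. The arrangement is supersolvable if there is a maximal chain $V=X_0\supsetneq X_1\supsetneq\dots\supsetneq X_r=T(\mathcal A)$ in $L(\mathcal A)$ consisting of modular elements (if $\mathcal A$ is essential, then $r=\dim V$ and $X_r=\{0\}$). Let $S=S(V^*)$, for each $H\in\mathcal A$ fix $\alpha_H\in V^*$ with $H=\ker\alpha_H$, let $Q=\prod_{H\in\mathcal A}\alpha_H\in S$, and let $D(\mathcal A)=\{\theta\in\operatorname{Der}_{\mathbb C}(S)\mid\theta(Q)\in QS\}$. A derivation $\theta$ of $S$ is homogeneous of polynomial degree $p$ if $\theta(\alpha)\in S_p$ for all $\alpha\in V^*$. If the $S$-module $D(\mathcal A)$ is free,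 it has a basis of $\dim V$ homogeneous derivations, and the multiset $\exp\mathcal A$ of exponents of $\mathcal A$ is the (uniquely determined) multiset of their polynomial degrees. **Proposition.** Let $(\mathcal A_1,V_1)$ and $(\mathcal A_2,V_2)$ be two arrangements, and let $$\mathcal A=\mathcal A_1\times\mathcal A_2=\{H_1\oplus V_2\mid H_1\in\mathcal A_1\}\cup\{V_1\oplus H_2\mid H_2\in\mathcal A_2\}$$ be their product in $V_1\oplus V_2$. Then $\mathcal A$ is supersolvable if and only if both $\mathcal A_1$ and $\mathcal A_2$ are supersolvable. In that case $\mathcal A_1$, $\mathcal A_2$ and $\mathcal A$ are free, their exponents are well defined, and $\exp\mathcal A$ is the multiset union (with multiplicities added) of $\exp\mathcal A_1$ and $\exp\mathcal A_2$. -/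

import Mathlib

/-- A (central) hyperplane arrangement in a complex vector space `V`: a finite collection of linear
hyperplanes, i.e. of kernels of nonzero linear forms. -/
structure HypArrangement (V : Type*) [AddCommGroup V] [Module ℂ V] where
  hyperplanes : Finset (Submodule ℂ V)
  exists_form : ∀ H ∈ hyperplanes, ∃ α : Module.Dual ℂ V, α ≠ 0 ∧ LinearMap.ker α = H

namespace HypArrangement

section Basic

variable {V : Type*} [AddCommGroup V] [Module ℂ V]

/-- The intersection lattice `L(A)`: all intersections of subsets of `A`; the empty intersection
is `V`. It is ordered by reverse inclusion. -/
def lattice (A : HypArrangement V) : Set (Submodule ℂ V) :=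
  {X | ∃ B ⊆ A.hyperplanes, X = B.inf id}

/-- The intersection of all hyperplanes of `A`, the maximal element of `L(A)` under reverse
inclusion. It is `{0}` exactly when `A` is essential. -/
def center (A : HypArrangement V) : Submodule ℂ V :=
  A.hyperplanes.inf id

/-- The rank `r(A)`: the codimension in `V` of the maximal element of `L(A)`. -/
noncomputable def rank (A : HypArrangement V) : ℕ :=
  Module.finrank ℂ (V ⧸ A.center)

/-- `X ∈ L(A)` is modular if `X + Y ∈ L(A)` for all `Y ∈ L(A)`. -/
def IsModular (A : HypArrangement V) (X : Submodule ℂ V) : Prop :=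
  X ∈ A.lattice ∧ ∀ Y ∈ A.lattice, X ⊔ Y ∈ A.lattice

/-- `A` is supersolvable if `L(A)` has a maximal chain `V = X₀ ⊋ X₁ ⊋ ⋯ ⊋ X_r` of modular elements,
where `r = r(A)` and `X_r` is the intersection of all hyperplanes. (For an essential arrangement,
`r = dim V` and `X_r = {0}`.) -/
def IsSupersolvable (A : HypArrangement V) : Prop :=
  ∃ X : Fin (A.rank + 1) → Submodule ℂ V,
    X 0 = ⊤ ∧ X (Fin.last A.rank) = A.center ∧ StrictAnti X ∧ ∀ i, A.IsModular (X i)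

end Basic

section Product

variable {V₁ V₂ : Type*} [AddCommGroup V₁] [Module ℂ V₁] [AddCommGroup V₂] [Module ℂ V₂]

open Classical in
/-- The product arrangement in `V₁ ⊕ V₂`, consisting of all `H₁ ⊕ V₂` with `H₁ ∈ A₁` and all
`V₁ ⊕ H₂` with `H₂ ∈ A₂`. -/
noncomputable def prod (A₁ : HypArrangement V₁) (A₂ : HypArrangement V₂) :
    HypArrangement (V₁ × V₂) where
  hyperplanes :=
    A₁.hyperplanes.image (fun H => H.prod (⊤ : Submodule ℂ V₂)) ∪
      A₂.hyperplanes.image (fun H => (⊤ : Submodule ℂ V₁).prod H)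
  exists_form := by
    intro H hH
    rw [Finset.mem_union, Finset.mem_image, Finset.mem_image] at hH
    rcases hH with ⟨K, hK, rfl⟩ | ⟨K, hK, rfl⟩
    · obtain ⟨α, hα, rfl⟩ := A₁.exists_form K hK
      refine ⟨α.comp (LinearMap.fst ℂ V₁ V₂), fun h => hα ?_, ?_⟩
      · ext v
        simpa using LinearMap.congr_fun h (v, 0)
      · ext v
        simp
    · obtain ⟨α, hα, rfl⟩ := A₂.exists_form K hK
      refine ⟨α.comp (LinearMap.snd ℂ V₁ V₂), fun h => hα ?_, ?_⟩
      · ext v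
        simpa using LinearMap.congr_fun h (0, v)
      · ext v
        simp

end Product

section Derivations

variable {V : Type*} [AddCommGroup V] [Module ℂ V]

/-- The coordinate ring `S = S(V*)`, the symmetric algebra of the dual space. -/
abbrev CoordRing (V : Type*) [AddCommGroup V] [Module ℂ V] : Type _ :=
  SymmetricAlgebra ℂ (Module.Dual ℂ V)

/-- A linear form, viewed as an element of degree one of `S`. -/
noncomputable abbrev linForm : Module.Dual ℂ V →ₗ[ℂ] CoordRing V :=
  SymmetricAlgebra.ι ℂ (Module.Dual ℂ V)

/-- The homogeneous component `S_p`, spanned by the products of `p` linear forms. -/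
noncomputable def homogeneousPart (V : Type*) [AddCommGroup V] [Module ℂ V] (p : ℕ) :
    Submodule ℂ (CoordRing V) :=
  LinearMap.range (linForm (V := V)) ^ p

/-- A derivation `θ` of `S` is homogeneous of polynomial degree `p` if `θ(α) ∈ S_p` for every
linear form `α`; with coordinates `x_i` and `θ = ∑ f_i ∂/∂x_i`, this says that all
`f_i = θ(x_i)` lie in `S_p`. -/
def IsHomogeneousDer (θ : Derivation ℂ (CoordRing V) (CoordRing V)) (p : ℕ) : Prop :=
  ∀ α : Module.Dual ℂ V, θ (linForm α) ∈ homogeneousPart V p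

/-- A fixed linear form with kernel `H`, for each `H ∈ A`. -/
noncomputable def form (A : HypArrangement V) (H : A.hyperplanes) : Module.Dual ℂ V :=
  (A.exists_form H.1 H.2).choose

/-- The defining polynomial `Q(A)`, the product of the chosen linear forms. -/
noncomputable def definingPoly (A : HypArrangement V) : CoordRing V :=
  ∏ H : A.hyperplanes, linForm (A.form H)

/-- The `S`-module `D(A)` of `A`-derivations: the derivations `θ` of `S` with `θ(Q) ∈ Q S`. -/
def derivations (A : HypArrangement V) :
    Submodule (CoordRing V) (Derivation ℂ (CoordRing V) (CoordRing V)) where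
  carrier := {θ | A.definingPoly ∣ θ A.definingPoly}
  add_mem' := fun {a b} ha hb => by
    change A.definingPoly ∣ (a + b) A.definingPoly
    rw [Derivation.add_apply]
    exact dvd_add ha hb
  zero_mem' := by
    change A.definingPoly ∣ (0 : Derivation ℂ (CoordRing V) (CoordRing V)) A.definingPoly
    rw [Derivation.zero_apply]
    exact dvd_zero _
  smul_mem' := fun c θ hθ => by
    change A.definingPoly ∣ (c • θ) A.definingPoly
    rw [Derivation.smul_apply, smul_eq_mul]
    exact Dvd.dvd.mul_left hθ c

/-- `A` is free and the multiset `e` is the multiset of polynomial degrees of a homogeneous basis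
of the `S`-module `D(A)`, consisting of `dim V` derivations. -/
def HasExponents (A : HypArrangement V) (e : Multiset ℕ) : Prop :=
  ∃ (b : Module.Basis (Fin (Module.finrank ℂ V)) (CoordRing V) A.derivations)
    (d : Fin (Module.finrank ℂ V) → ℕ),
    (∀ i, IsHomogeneousDer (b i : Derivation ℂ (CoordRing V) (CoordRing V)) (d i)) ∧
      e = Finset.univ.val.map d

end Derivations

end HypArrangement

/-! Supersolvability. Lattice elements of a product are products `X₁ × X₂`, and sums are formed
factorwise, so such an element is modular exactly when both factors are (`isModular_prod_iff`).
Hence two modular chains concatenate. Conversely, along a maximal modular chain of the product the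
dimension drops by one per step, so exactly one factor drops, by one; discarding repetitions in each
factor leaves a maximal chain there (`isSupersolvable_of_steps`).

Exponents. A modular chain yields a basis of the dual space in which every hyperplane is `ker (x i -
a)`, the node `a` being a combination of lower coordinates. Modularity makes the difference of two
nodes at `i` define a hyperplane of lower level (`IsModularChain.exists_fiberedBasis`). Then `D(A)`
has a triangular homogeneous basis: `θ i` kills the lower coordinates, sends `x i` to the product of
the `x i - a`, and is prolonged to the higher coordinates one at a time. To prolong to `x k`, take a
polynomial `F` over `S` with `F(a) = θ(a)` at all nodes `a` and use `F(x k)`, because `x k - a`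
divides `F(x k) - F(a)`. Such an `F` exists by Newton interpolation (`exists_interpolation`); the
divisibilities it needs come from the lower hyperplanes. The exponents are thus the numbers of
nodes, and juxtaposing fibered bases of the factors adds them.

Uniqueness of exponents compares two homogeneous bases through the constant terms of the
change-of-basis matrix (`HasExponents.unique`). -/

namespace HypArrangement

/-! ### The symmetric algebra: grading and divisibility by linear forms -/

section CoordRing

variable {V : Type*} [AddCommGroup V] [Module ℂ V]

/-- The dilation of the coordinate ring that multiplies each linear form by `t`. -/
noncomputable def dilation (t : ℂ) : CoordRing V →ₐ[ℂ] CoordRing V :=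
  SymmetricAlgebra.lift (t • linForm (V := V))

lemma dilation_linForm (t : ℂ) (α : Module.Dual ℂ V) :
    dilation t (linForm α) = t • linForm α := by
  simp [dilation]

lemma dilation_of_mem_homogeneousPart (t : ℂ) {p : ℕ} {f : CoordRing V}
    (hf : f ∈ homogeneousPart V p) : dilation t f = t ^ p • f := by
  induction p generalizing f with
  | zero =>
    rw [homogeneousPart, pow_zero, Submodule.mem_one] at hf
    obtain ⟨c, rfl⟩ := hf
    simp
  | succ p ih =>
    rw [homogeneousPart, pow_succ] at hf
    induction hf using Submodule.mul_induction_on' with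
    | mem_mul_mem a ha b hb =>
      obtain ⟨α, rfl⟩ := hb
      rw [map_mul, ih ha, dilation_linForm, pow_succ, smul_mul_smul_comm]
    | add a _ b _ iha ihb => rw [map_add, iha, ihb, smul_add]

/-- The constant term ignores dilation, since both sides kill all linear forms. This isolates the
degree-zero coefficients when two bases are compared. -/
lemma algebraMapInv_dilation (t : ℂ) (f : CoordRing V) :
    SymmetricAlgebra.algebraMapInv (R := ℂ) (M := Module.Dual ℂ V) (dilation t f) =
      SymmetricAlgebra.algebraMapInv f := by
  have : (SymmetricAlgebra.algebraMapInv (R := ℂ) (M := Module.Dual ℂ V)).comp (dilation t) =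
      SymmetricAlgebra.algebraMapInv := by
    apply SymmetricAlgebra.algHom_ext
    ext α
    simp [dilation_linForm, SymmetricAlgebra.algebraMapInv_ι]
  exact DFunLike.congr_fun this f

lemma linForm_mem_homogeneousPart (α : Module.Dual ℂ V) : linForm α ∈ homogeneousPart V 1 := by
  rw [homogeneousPart, pow_one]
  exact ⟨α, rfl⟩

lemma algebraMap_mem_homogeneousPart (c : ℂ) :
    algebraMap ℂ (CoordRing V) c ∈ homogeneousPart V 0 := by
  rw [homogeneousPart, pow_zero]
  exact Submodule.mem_one.2 ⟨c, rfl⟩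

lemma prod_linForm_mem_homogeneousPart {ι : Type*} (s : Finset ι) (a : ι → Module.Dual ℂ V) :
    ∏ i ∈ s, linForm (a i) ∈ homogeneousPart V s.card := by
  classical
  induction s using Finset.induction_on with
  | empty => simpa using algebraMap_mem_homogeneousPart (V := V) 1
  | insert i s hi ih =>
    rw [Finset.prod_insert hi, Finset.card_insert_of_notMem hi, homogeneousPart, pow_succ']
    exact Submodule.mul_mem_mul ⟨a i, rfl⟩ ih

lemma linForm_injective : Function.Injective (linForm (V := V)) := by
  intro α β h
  ext v
  have := congrArg (SymmetricAlgebra.lift (Module.Dual.eval ℂ V v)) h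
  simpa using this

lemma linForm_ne_zero {α : Module.Dual ℂ V} (hα : α ≠ 0) : linForm α ≠ 0 := by
  rw [← map_zero linForm]
  exact linForm_injective.ne hα

/-- Evaluation at a point `v` is a ring homomorphism, so divisibility survives at each zero of `α`.
-/
lemma ker_le_ker_of_linForm_dvd {α β : Module.Dual ℂ V} (h : linForm α ∣ linForm β) :
    LinearMap.ker α ≤ LinearMap.ker β := by
  intro v hv
  have := map_dvd (SymmetricAlgebra.lift (Module.Dual.eval ℂ V v)) h
  simpa [LinearMap.mem_ker.1 hv] using this

lemma exists_smul_eq_of_ker_le {α β : Module.Dual ℂ V}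
    (h : LinearMap.ker α ≤ LinearMap.ker β) : ∃ c : ℂ, β = c • α := by
  by_cases hα : α = 0
  · subst hα
    refine ⟨0, ?_⟩
    ext v
    simpa using h (show v ∈ LinearMap.ker (0 : Module.Dual ℂ V) by simp)
  · obtain ⟨w, hw⟩ : ∃ w, α w ≠ 0 := by
      by_contra! hc
      exact hα (LinearMap.ext hc)
    refine ⟨β w / α w, ?_⟩
    ext v
    have : v - (α v / α w) • w ∈ LinearMap.ker β := h (by simp [hw])
    rw [LinearMap.mem_ker, map_sub, map_smul, sub_eq_zero] at this
    rw [this, LinearMap.smul_apply, smul_eq_mul, smul_eq_mul]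
    field_simp

lemma linForm_dvd_of_ker_le {α β : Module.Dual ℂ V}
    (h : LinearMap.ker α ≤ LinearMap.ker β) : linForm α ∣ linForm β := by
  obtain ⟨c, rfl⟩ := exists_smul_eq_of_ker_le h
  rw [map_smul]
  exact dvd_smul_of_dvd c dvd_rfl

lemma derivation_ext {θ η : Derivation ℂ (CoordRing V) (CoordRing V)}
    (h : ∀ α, θ (linForm α) = η (linForm α)) : θ = η := by
  ext f
  induction f using SymmetricAlgebra.induction with
  | algebraMap r => simp
  | ι α => exact h α
  | mul a b ha hb => rw [Derivation.leibniz, Derivation.leibniz, ha, hb]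
  | add a b ha hb => rw [map_add, map_add, ha, hb]

lemma derivation_ext_basis {ι : Type*} (x : Module.Basis ι ℂ (Module.Dual ℂ V))
    {θ η : Derivation ℂ (CoordRing V) (CoordRing V)}
    (h : ∀ i, θ (linForm (x i)) = η (linForm (x i))) : θ = η := by
  refine derivation_ext fun α => ?_
  have : (θ : CoordRing V →ₗ[ℂ] CoordRing V) ∘ₗ linForm =
      (η : CoordRing V →ₗ[ℂ] CoordRing V) ∘ₗ linForm := x.ext h
  exact DFunLike.congr_fun this α

lemma exists_derivation {ι : Type*} (x : Module.Basis ι ℂ (Module.Dual ℂ V))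
    (f : ι → CoordRing V) :
    ∃ θ : Derivation ℂ (CoordRing V) (CoordRing V), ∀ i, θ (linForm (x i)) = f i := by
  let e := SymmetricAlgebra.equivMvPolynomial x
  let D := MvPolynomial.mkDerivation ℂ fun i => e (f i)
  refine ⟨Derivation.mk' (e.symm.toLinearMap ∘ₗ (D : _ →ₗ[ℂ] _) ∘ₗ e.toLinearMap) ?_, ?_⟩
  · intro a b
    simp [Derivation.leibniz]
  · intro i
    change e.symm (D (e (linForm (x i)))) = f i
    rw [show e (linForm (x i)) = MvPolynomial.X i from
      SymmetricAlgebra.equivMvPolynomial_ι_apply x i, MvPolynomial.mkDerivation_X, e.symm_apply_apply]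

lemma mem_homogeneousPart_iff {ι : Type*} (x : Module.Basis ι ℂ (Module.Dual ℂ V)) (p : ℕ)
    (f : CoordRing V) :
    f ∈ homogeneousPart V p ↔ (SymmetricAlgebra.equivMvPolynomial x f).IsHomogeneous p := by
  let e := SymmetricAlgebra.equivMvPolynomial x
  have h1 : (homogeneousPart V p).map e.toLinearMap =
      MvPolynomial.homogeneousSubmodule ι ℂ p := by
    rw [← MvPolynomial.homogeneousSubmodule_one_pow, homogeneousPart]
    have : (LinearMap.range (linForm (V := V))).map e.toLinearMap =
        MvPolynomial.homogeneousSubmodule ι ℂ 1 := by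
      rw [MvPolynomial.homogeneousSubmodule_one_eq_span_X, LinearMap.range_eq_map, ← x.span_eq,
        Submodule.map_span, Submodule.map_span, ← Set.range_comp, ← Set.range_comp]
      congr 2
      ext i
      simp [e]
    rw [← this]
    exact Submodule.map_pow _ e.toAlgHom p
  rw [← MvPolynomial.mem_homogeneousSubmodule, ← h1]
  constructor
  · intro h
    exact ⟨f, h, rfl⟩
  · rintro ⟨g, hg, hgf⟩
    rwa [← e.injective hgf]

/-- Completing `α` to a basis of the dual space turns it into a variable of a polynomial ring. -/
lemma prime_linForm {α : Module.Dual ℂ V} (hα : α ≠ 0) : Prime (linForm α) := by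
  have hli : LinearIndepOn ℂ id {α} := LinearIndepOn.singleton hα
  let b := Module.Basis.extend hli
  let i : hli.extend (Set.subset_univ _) := ⟨α, hli.subset_extend _ rfl⟩
  have hi : b i = α := Module.Basis.extend_apply_self hli i
  let e := SymmetricAlgebra.equivMvPolynomial b
  rw [← MulEquiv.prime_iff e.toMulEquiv]
  have : e (linForm α) = MvPolynomial.X i :=
    (congrArg (fun β => e (linForm β)) hi).symm.trans
      (SymmetricAlgebra.equivMvPolynomial_ι_apply b i)
  change Prime (e (linForm α))
  rw [this]
  exact MvPolynomial.X_prime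

variable [FiniteDimensional ℂ V]

instance : UniqueFactorizationMonoid (CoordRing V) :=
  (SymmetricAlgebra.equivMvPolynomial
    (Module.finBasis ℂ (Module.Dual ℂ V))).symm.toMulEquiv.uniqueFactorizationMonoid inferInstance

lemma isRelPrime_linForm {α β : Module.Dual ℂ V} (hα : α ≠ 0) (hβ : β ≠ 0)
    (h : LinearMap.ker α ≠ LinearMap.ker β) : IsRelPrime (linForm α) (linForm β) := by
  rw [(prime_linForm hα).irreducible.isRelPrime_iff_not_dvd]
  intro hd
  obtain ⟨c, rfl⟩ := exists_smul_eq_of_ker_le (ker_le_ker_of_linForm_dvd hd)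
  refine h (LinearMap.ker_smul _ _ ?_).symm
  rintro rfl
  simp at hβ

/-- A homogeneous projection of degree `p` preserves divisibility by linear forms. -/
lemma exists_homogeneous_projection (p : ℕ) :
    ∃ π : CoordRing V →ₗ[ℂ] CoordRing V, (∀ f, π f ∈ homogeneousPart V p) ∧
      (∀ f ∈ homogeneousPart V p, π f = f) ∧
      ∀ α f, linForm α ∣ f → linForm α ∣ π f := by
  let x := Module.finBasis ℂ (Module.Dual ℂ V)
  let e := SymmetricAlgebra.equivMvPolynomial x
  refine ⟨e.symm.toLinearMap ∘ₗ MvPolynomial.homogeneousComponent p ∘ₗ e.toLinearMap,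
    fun f => ?_, fun f hf => ?_, fun α f hf => ?_⟩
  · rw [mem_homogeneousPart_iff x]
    simpa [e] using MvPolynomial.homogeneousComponent_isHomogeneous p (e f)
  · rw [mem_homogeneousPart_iff x] at hf
    simp [e, MvPolynomial.homogeneousComponent_eq_self hf]
  · have hα : (e (linForm α)).IsHomogeneous 1 :=
      (mem_homogeneousPart_iff x 1 _).1 (linForm_mem_homogeneousPart α)
    let _ := MvPolynomial.gradedAlgebra (σ := Fin (Module.finrank ℂ (Module.Dual ℂ V))) (R := ℂ)
    -- An ideal generated by a homogeneous element contains all homogeneous components of its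
    -- members.
    have hI : (Ideal.span {e (linForm α)}).IsHomogeneous
        (MvPolynomial.homogeneousSubmodule _ ℂ) := by
      apply Ideal.homogeneous_span
      rintro _ rfl
      exact ⟨1, hα⟩
    have := MvPolynomial.homogeneousComponent_mem_of_mem hI
      (Ideal.mem_span_singleton.2 (map_dvd e hf)) p
    rw [Ideal.mem_span_singleton] at this
    simpa using map_dvd e.symm this

end CoordRing

end HypArrangement

namespace HypArrangement

/-! ### Membership in `D(A)` and interpolation of derivations -/

section Derivations

variable {V : Type*} [AddCommGroup V] [Module ℂ V]

lemma derivation_eq_of_mem_span {ι : Type*} {x : ι → Module.Dual ℂ V} {t : Set ι}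
    {θ η : Derivation ℂ (CoordRing V) (CoordRing V)}
    (h : ∀ i ∈ t, θ (linForm (x i)) = η (linForm (x i))) {a : Module.Dual ℂ V}
    (ha : a ∈ Submodule.span ℂ (x '' t)) : θ (linForm a) = η (linForm a) := by
  have : Set.EqOn ((θ : CoordRing V →ₗ[ℂ] CoordRing V) ∘ₗ linForm)
      ((η : CoordRing V →ₗ[ℂ] CoordRing V) ∘ₗ linForm) (x '' t) := by
    rintro _ ⟨i, hi, rfl⟩
    exact h i hi
  exact LinearMap.eqOn_span this ha

lemma derivation_eq_zero_of_mem_span {ι : Type*} {x : ι → Module.Dual ℂ V} {t : Set ι}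
    {θ : Derivation ℂ (CoordRing V) (CoordRing V)}
    (h : ∀ i ∈ t, θ (linForm (x i)) = 0) {a : Module.Dual ℂ V}
    (ha : a ∈ Submodule.span ℂ (x '' t)) : θ (linForm a) = 0 := by
  simpa using derivation_eq_of_mem_span (η := 0) (by simpa using h) ha

lemma isHomogeneousDer_of_basis {ι : Type*} (x : Module.Basis ι ℂ (Module.Dual ℂ V))
    {θ : Derivation ℂ (CoordRing V) (CoordRing V)} {p : ℕ}
    (h : ∀ i, θ (linForm (x i)) ∈ homogeneousPart V p) : IsHomogeneousDer θ p := by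
  intro α
  have : (⊤ : Submodule ℂ (Module.Dual ℂ V)) ≤
      (homogeneousPart V p).comap ((θ : CoordRing V →ₗ[ℂ] CoordRing V) ∘ₗ linForm) := by
    rw [← x.span_eq, Submodule.span_le]
    rintro _ ⟨i, rfl⟩
    exact h i
  exact this (Submodule.mem_top (x := α))

lemma linForm_dvd_apply_of_ker_eq {θ : Derivation ℂ (CoordRing V) (CoordRing V)}
    {α β : Module.Dual ℂ V} (h : LinearMap.ker α = LinearMap.ker β)
    (hα : linForm α ∣ θ (linForm α)) : linForm β ∣ θ (linForm β) := by
  obtain ⟨c, hc⟩ := exists_smul_eq_of_ker_le h.le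
  have h1 : θ (linForm β) = c • θ (linForm α) := by rw [hc, map_smul, Derivation.map_smul]
  rw [h1]
  exact dvd_smul_of_dvd c ((linForm_dvd_of_ker_le h.ge).trans hα)

lemma prod_dvd_derivation_prod {R : Type*} [CommRing R] [Algebra ℂ R] (θ : Derivation ℂ R R)
    {ι : Type*} (s : Finset ι) (f : ι → R) (h : ∀ i ∈ s, f i ∣ θ (f i)) :
    ∏ i ∈ s, f i ∣ θ (∏ i ∈ s, f i) := by
  classical
  induction s using Finset.induction_on with
  | empty => simp
  | insert i s hi ih =>
    rw [Finset.prod_insert hi, Derivation.leibniz, smul_eq_mul, smul_eq_mul]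
    refine dvd_add (mul_dvd_mul_left _ (ih fun j hj => h j (Finset.mem_insert_of_mem hj))) ?_
    rw [mul_comm (f i)]
    exact mul_dvd_mul_left _ (h i (Finset.mem_insert_self _ _))

lemma form_ne_zero (A : HypArrangement V) (H : A.hyperplanes) : A.form H ≠ 0 :=
  (A.exists_form H.1 H.2).choose_spec.1

lemma ker_form (A : HypArrangement V) (H : A.hyperplanes) : LinearMap.ker (A.form H) = H.1 :=
  (A.exists_form H.1 H.2).choose_spec.2

/-- Modulo one linear factor of `Q`, the Leibniz rule leaves only the term differentiating that
factor; its cofactor is prime to it because distinct hyperplanes give non-associated primes. -/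
lemma mem_derivations_iff (A : HypArrangement V) [FiniteDimensional ℂ V]
    {θ : Derivation ℂ (CoordRing V) (CoordRing V)} :
    θ ∈ A.derivations ↔
      ∀ α : Module.Dual ℂ V, LinearMap.ker α ∈ A.hyperplanes → linForm α ∣ θ (linForm α) := by
  classical
  constructor
  · intro h α hα
    let H : A.hyperplanes := ⟨_, hα⟩
    refine linForm_dvd_apply_of_ker_eq (A.ker_form H) ?_
    have hp := prime_linForm (A.form_ne_zero H)
    have hQ : A.definingPoly = linForm (A.form H) *
        ∏ K ∈ Finset.univ.erase H, linForm (A.form K) :=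
      (Finset.mul_prod_erase _ _ (Finset.mem_univ H)).symm
    have h1 : linForm (A.form H) ∣ θ A.definingPoly := (Dvd.intro _ hQ.symm).trans h
    rw [hQ, Derivation.leibniz, smul_eq_mul, smul_eq_mul,
      dvd_add_right (dvd_mul_right _ _)] at h1
    refine (hp.dvd_or_dvd h1).resolve_left fun h2 => ?_
    obtain ⟨K, hK, hd⟩ := (hp.dvd_finsetProd_iff _).1 h2
    refine (Finset.mem_erase.1 hK).1 ?_
    obtain ⟨c, hc⟩ := exists_smul_eq_of_ker_le (ker_le_ker_of_linForm_dvd hd)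
    have hc0 : c ≠ 0 := by
      rintro rfl
      exact A.form_ne_zero K (by simpa using hc)
    rw [Subtype.ext_iff, ← A.ker_form, ← A.ker_form H, hc, LinearMap.ker_smul _ _ hc0]
  · intro h
    exact prod_dvd_derivation_prod θ _ _ fun H _ => h _ (by rw [A.ker_form]; exact H.2)

open Polynomial in
lemma prod_X_sub_C_dvd_of_eval_eq_zero {R : Type*} [CommRing R] [IsDomain R] (s : Finset R)
    (F : R[X]) (h : ∀ a ∈ s, F.eval a = 0) : ∏ a ∈ s, (X - C a) ∣ F := by
  by_cases hF : F = 0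
  · simp [hF]
  · refine (Multiset.prod_X_sub_C_dvd_iff_le_roots hF s.val).2 ?_
    rw [Multiset.le_iff_subset s.nodup]
    intro a ha
    exact (mem_roots hF).2 (h a ha)

variable [FiniteDimensional ℂ V]

open Polynomial in
-- This is the divisibility that lets Newton interpolation take on a new node `m`. Different `m - a`
-- may be proportional, so coprimality holds only between classes with equal kernel; within a class
-- the full power must be obtained by a separate argument.
lemma prod_linForm_sub_dvd {θ : Derivation ℂ (CoordRing V) (CoordRing V)}
    {m : Module.Dual ℂ V} {s : Finset (Module.Dual ℂ V)} (hm : m ∉ s)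
    (h : ∀ a ∈ s, linForm (m - a) ∣ θ (linForm (m - a)))
    {F : (CoordRing V)[X]} (hF : ∀ a ∈ s, F.eval (linForm a) = θ (linForm a)) :
    ∏ a ∈ s, linForm (m - a) ∣ F.eval (linForm m) - θ (linForm m) := by
  classical
  have hne : ∀ a ∈ s, m - a ≠ 0 := fun a ha h0 => hm (sub_eq_zero.1 h0 ▸ ha)
  rw [← Finset.prod_fiberwise_of_maps_to
    (fun a ha => Finset.mem_image_of_mem (fun a => LinearMap.ker (m - a)) ha)]
  refine Finset.prod_dvd_of_isRelPrime ?_ ?_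
  · intro K _ L _ hKL
    refine IsRelPrime.prod_left fun a ha => IsRelPrime.prod_right fun b hb => ?_
    rw [Finset.mem_filter] at ha hb
    refine isRelPrime_linForm (hne a ha.1) (hne b hb.1) ?_
    rw [ha.2, hb.2]
    exact hKL
  · intro K hK
    obtain ⟨b, hb, rfl⟩ := Finset.mem_image.1 hK
    obtain ⟨g, hg⟩ := h b hb
    -- On the nodes of one class, `θ` agrees with the affine polynomial `θ(m) + g (X - m)` with the
    -- same slope `g`, so `G` vanishes there; its value at `m` is `F(m) - θ(m)`.
    let G : (CoordRing V)[X] := F - C (θ (linForm m)) - C g * (X - C (linForm m))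
    have hG : ∏ a ∈ (s.filter fun a => LinearMap.ker (m - a) = LinearMap.ker (m - b)).image
        linForm, (X - C a) ∣ G := by
      apply prod_X_sub_C_dvd_of_eval_eq_zero
      intro _ hy
      obtain ⟨a, ha, rfl⟩ := Finset.mem_image.1 hy
      rw [Finset.mem_filter] at ha
      obtain ⟨c, hc⟩ := exists_smul_eq_of_ker_le ha.2.ge
      have h1 : θ (linForm m) - θ (linForm a) = g * (linForm m - linForm a) := by
        rw [← map_sub, ← map_sub, hc, map_smul, Derivation.map_smul, hg, mul_smul_comm, mul_comm]
      simp only [G, eval_sub, eval_mul, eval_C, eval_X, hF a ha.1]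
      linear_combination -h1
    rw [Finset.prod_image (fun a _ b _ hab => linForm_injective hab)] at hG
    have := eval_dvd (x := linForm m) hG
    rw [eval_prod] at this
    simpa [G] using this

open Polynomial in
/-- A derivation that preserves the ideals of all differences of the nodes is interpolated on the
nodes by a polynomial. -/
lemma exists_interpolation (θ : Derivation ℂ (CoordRing V) (CoordRing V))
    (s : Finset (Module.Dual ℂ V))
    (h : ∀ a ∈ s, ∀ b ∈ s, linForm (a - b) ∣ θ (linForm (a - b))) :
    ∃ F : (CoordRing V)[X], ∀ a ∈ s, F.eval (linForm a) = θ (linForm a) := by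
  classical
  induction s using Finset.induction_on with
  | empty => exact ⟨0, by simp⟩
  | insert m s hm ih =>
    obtain ⟨F, hF⟩ := ih fun a ha b hb =>
      h a (Finset.mem_insert_of_mem ha) b (Finset.mem_insert_of_mem hb)
    obtain ⟨c, hc⟩ := prod_linForm_sub_dvd hm
      (fun a ha => h m (Finset.mem_insert_self _ _) a (Finset.mem_insert_of_mem ha)) hF
    -- Newton's correction: it vanishes at the old nodes and repairs the value at `m`.
    refine ⟨F - C c * ∏ a ∈ s, (X - C (linForm a)), fun a ha => ?_⟩
    rw [eval_sub, eval_mul, eval_C, eval_prod]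
    simp only [eval_sub, eval_X, eval_C]
    rcases Finset.mem_insert.1 ha with rfl | ha
    · simp only [map_sub] at hc
      linear_combination hc
    · rw [Finset.prod_eq_zero ha (sub_self _), hF a ha]
      simp

end Derivations

/-! ### Fibered bases and triangular derivations -/

/-- A basis `x` of the dual space adapted to `A`: every hyperplane is the kernel of `x i - a` for
some `i` and a node `a` in the span of the basis vectors of lower level, and the difference of two
nodes at `i` defines a hyperplane of lower level. -/
structure FiberedBasis {V : Type*} [AddCommGroup V] [Module ℂ V] (A : HypArrangement V)
    (ι : Type*) where
  x : Module.Basis ι ℂ (Module.Dual ℂ V)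
  level : ι → ℕ
  level_injective : Function.Injective level
  nodes : ι → Finset (Module.Dual ℂ V)
  mem_span : ∀ i, ∀ a ∈ nodes i, a ∈ Submodule.span ℂ (x '' {j | level j < level i})
  ker_mem : ∀ i, ∀ a ∈ nodes i, LinearMap.ker (x i - a) ∈ A.hyperplanes
  exists_node : ∀ H ∈ A.hyperplanes, ∃ i, ∃ a ∈ nodes i, LinearMap.ker (x i - a) = H
  exists_lower : ∀ i, ∀ a ∈ nodes i, ∀ b ∈ nodes i, a ≠ b →
    ∃ j, level j < level i ∧ ∃ c ∈ nodes j, LinearMap.ker (x j - c) = LinearMap.ker (a - b)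

namespace FiberedBasis

variable {V : Type*} [AddCommGroup V] [Module ℂ V]
  {A : HypArrangement V} {ι : Type*} (B : A.FiberedBasis ι)

lemma sub_node_ne_zero (i : ι) {a : Module.Dual ℂ V} (ha : a ∈ B.nodes i) : B.x i - a ≠ 0 := by
  intro h
  obtain ⟨α, hα, hk⟩ := A.exists_form _ (B.ker_mem i a ha)
  rw [h, LinearMap.ker_zero, LinearMap.ker_eq_top] at hk
  exact hα hk

variable [FiniteDimensional ℂ V]

lemma mem_derivations_iff {θ : Derivation ℂ (CoordRing V) (CoordRing V)} :
    θ ∈ A.derivations ↔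
      ∀ i, ∀ a ∈ B.nodes i, linForm (B.x i - a) ∣ θ (linForm (B.x i - a)) := by
  rw [A.mem_derivations_iff]
  constructor
  · intro h i a ha
    exact h _ (B.ker_mem i a ha)
  · intro h α hα
    obtain ⟨i, a, ha, hk⟩ := B.exists_node _ hα
    exact linForm_dvd_apply_of_ker_eq hk (h i a ha)

/-- Only the value on the coordinate `x k` of level `N` is changed. Differences of its nodes define
lower hyperplanes, which `θ` already respects, so some `F` interpolates `θ` on the nodes. The new
value is the degree `p` part of `F(x k)`; taking that part keeps divisibility by `x k - a`. -/
lemma exists_extension {θ : Derivation ℂ (CoordRing V) (CoordRing V)} {p N : ℕ}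
    (hθ : IsHomogeneousDer θ p)
    (h : ∀ i, B.level i < N → ∀ a ∈ B.nodes i,
      linForm (B.x i - a) ∣ θ (linForm (B.x i - a))) :
    ∃ η : Derivation ℂ (CoordRing V) (CoordRing V), IsHomogeneousDer η p ∧
      (∀ i, B.level i < N → η (linForm (B.x i)) = θ (linForm (B.x i))) ∧
      ∀ i, B.level i < N + 1 → ∀ a ∈ B.nodes i,
        linForm (B.x i - a) ∣ η (linForm (B.x i - a)) := by
  classical
  by_cases hk : ∃ k, B.level k = N
  swap
  · refine ⟨θ, hθ, fun _ _ => rfl, fun i hi => h i ?_⟩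
    exact lt_of_le_of_ne (Nat.lt_succ_iff.1 hi) fun h' => hk ⟨i, h'⟩
  obtain ⟨k, rfl⟩ := hk
  obtain ⟨F, hF⟩ := exists_interpolation θ (B.nodes k) (by
    intro a ha b hb
    by_cases hab : a = b
    · simp [hab]
    obtain ⟨j, hj, c, hc, hker⟩ := B.exists_lower k a ha b hb hab
    exact linForm_dvd_apply_of_ker_eq hker (h j hj c hc))
  obtain ⟨π, hπ, hπ_id, hπ_dvd⟩ := exists_homogeneous_projection (V := V) p
  obtain ⟨η, hη⟩ := exists_derivation B.x
    (Function.update (fun i => θ (linForm (B.x i))) k (π (F.eval (linForm (B.x k)))))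
  have hη_k : η (linForm (B.x k)) = π (F.eval (linForm (B.x k))) := by
    rw [hη, Function.update_self]
  have hη_ne : ∀ i, i ≠ k → η (linForm (B.x i)) = θ (linForm (B.x i)) := fun i hi => by
    rw [hη, Function.update_of_ne hi]
  have hη_span : ∀ i, B.level i ≤ B.level k → ∀ a ∈ B.nodes i,
      η (linForm a) = θ (linForm a) := by
    intro i hi a ha
    refine derivation_eq_of_mem_span (fun j hj => hη_ne j ?_) (B.mem_span i a ha)
    rintro rfl
    exact not_lt.2 hi hj
  refine ⟨η, isHomogeneousDer_of_basis B.x fun i => ?_, fun i hi => hη_ne i ?_, ?_⟩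
  · by_cases hi : i = k
    · rw [hi, hη_k]
      exact hπ _
    · rw [hη_ne i hi]
      exact hθ _
  · rintro rfl
    exact lt_irrefl _ hi
  · intro i hi a ha
    by_cases hik : i = k
    · subst hik
      rw [map_sub, map_sub, hη_k, hη_span i le_rfl a ha, ← hπ_id _ (hθ a), ← map_sub π,
        ← map_sub linForm]
      apply hπ_dvd
      rw [map_sub, ← hF a ha]
      exact Polynomial.sub_dvd_eval_sub _ _ _
    · have := h i (lt_of_le_of_ne (Nat.lt_succ_iff.1 hi) fun h' => hik (B.level_injective h')) a ha
      rwa [map_sub, map_sub, hη_ne i hik, hη_span i (Nat.lt_succ_iff.1 hi) a ha, ← map_sub θ,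
        ← map_sub linForm]

/-- The derivation supported on the single coordinate `x i` is correct up to the level of `i`; the
remaining levels are repaired one by one with `exists_extension`. -/
lemma exists_triangular_derivation [Finite ι] (i : ι) :
    ∃ θ : Derivation ℂ (CoordRing V) (CoordRing V), θ ∈ A.derivations ∧
      IsHomogeneousDer θ (B.nodes i).card ∧
      (∀ j, B.level j < B.level i → θ (linForm (B.x j)) = 0) ∧
      θ (linForm (B.x i)) = ∏ a ∈ B.nodes i, linForm (B.x i - a) := by
  classical
  have key : ∀ m, ∃ θ : Derivation ℂ (CoordRing V) (CoordRing V),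
      IsHomogeneousDer θ (B.nodes i).card ∧
      (∀ j, B.level j < B.level i → θ (linForm (B.x j)) = 0) ∧
      θ (linForm (B.x i)) = ∏ a ∈ B.nodes i, linForm (B.x i - a) ∧
      ∀ j, B.level j < B.level i + 1 + m → ∀ a ∈ B.nodes j,
        linForm (B.x j - a) ∣ θ (linForm (B.x j - a)) := by
    intro m
    induction m with
    | zero =>
      obtain ⟨θ, hθ⟩ := exists_derivation B.x
        (Pi.single i (∏ a ∈ B.nodes i, linForm (B.x i - a)))
      have hθ_i : θ (linForm (B.x i)) = ∏ a ∈ B.nodes i, linForm (B.x i - a) := by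
        rw [hθ, Pi.single_eq_same]
      have hθ_ne : ∀ j, j ≠ i → θ (linForm (B.x j)) = 0 := fun j hj => by
        rw [hθ, Pi.single_eq_of_ne hj]
      have hθ_span : ∀ j, B.level j ≤ B.level i → ∀ a ∈ B.nodes j, θ (linForm a) = 0 := by
        intro j hj a ha
        refine derivation_eq_zero_of_mem_span (fun l hl => hθ_ne l ?_) (B.mem_span j a ha)
        rintro rfl
        exact not_lt.2 hj hl
      refine ⟨θ, isHomogeneousDer_of_basis B.x fun j => ?_, fun j hj => hθ_ne j ?_, hθ_i, ?_⟩
      · by_cases hj : j = i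
        · rw [hj, hθ_i]
          exact prod_linForm_mem_homogeneousPart _ _
        · rw [hθ_ne j hj]
          exact Submodule.zero_mem _
      · rintro rfl
        exact lt_irrefl _ hj
      · intro j hj a ha
        rw [map_sub, map_sub, hθ_span j (by omega) a ha, sub_zero, ← map_sub]
        by_cases hji : j = i
        · subst hji
          rw [hθ_i]
          exact Finset.dvd_prod_of_mem _ ha
        · rw [hθ_ne j hji]
          exact dvd_zero _
    | succ m ih =>
      obtain ⟨θ, h1, h2, h3, h4⟩ := ih
      obtain ⟨η, g1, g2, g3⟩ := B.exists_extension h1 h4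
      exact ⟨η, g1, fun j hj => (g2 j (by omega)).trans (h2 j hj), (g2 i (by omega)).trans h3, g3⟩
  obtain ⟨N, hN⟩ := (Set.finite_range B.level).bddAbove
  -- `N` bounds all levels, so after `N` extensions every level is covered.
  obtain ⟨θ, h1, h2, h3, h4⟩ := key N
  refine ⟨θ, B.mem_derivations_iff.2 fun j => h4 j ?_, h1, h2, h3⟩
  have := hN ⟨j, rfl⟩
  omega

/-- Each factor divides `θ (x i)` because `θ` kills the nodes. The factors are coprime: a common
kernel of `x i - a` and `x i - b` would make `a - b` a nonzero multiple of `x i - a`, placing `x i`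
in the span of lower coordinates. -/
lemma prod_dvd_apply {θ : Derivation ℂ (CoordRing V) (CoordRing V)} (hθ : θ ∈ A.derivations)
    {i : ι} (h : ∀ j, B.level j < B.level i → θ (linForm (B.x j)) = 0) :
    ∏ a ∈ B.nodes i, linForm (B.x i - a) ∣ θ (linForm (B.x i)) := by
  refine Finset.prod_dvd_of_isRelPrime ?_ ?_
  · intro a ha b hb hab
    refine isRelPrime_linForm (B.sub_node_ne_zero i ha) (B.sub_node_ne_zero i hb) fun hker => ?_
    obtain ⟨j, hj, c, hc, hker'⟩ := B.exists_lower i a ha b hb hab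
    have h1 : LinearMap.ker (B.x i - a) ≤ LinearMap.ker (a - b) := by
      intro v hv
      have hv' := hker ▸ hv
      simp only [LinearMap.mem_ker, LinearMap.sub_apply] at hv hv' ⊢
      linear_combination hv' - hv
    obtain ⟨c, hc⟩ := exists_smul_eq_of_ker_le h1
    by_cases hc0 : c = 0
    · rw [hc0, zero_smul] at hc
      exact hab (sub_eq_zero.1 hc)
    · have hmem : B.x i ∈ Submodule.span ℂ (B.x '' {j | B.level j < B.level i}) := by
        have h2 : B.x i = c⁻¹ • (a - b) + a := by rw [hc, inv_smul_smul₀ hc0, sub_add_cancel]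
        rw [h2]
        exact Submodule.add_mem _ (Submodule.smul_mem _ _ (Submodule.sub_mem _
          (B.mem_span i a ha) (B.mem_span i b hb))) (B.mem_span i a ha)
      have h3 : i ∈ {j | B.level j < B.level i} := B.x.self_mem_span_image.1 hmem
      exact lt_irrefl (B.level i) h3
  · intro a ha
    have := B.mem_derivations_iff.1 hθ i a ha
    rwa [map_sub linForm, map_sub θ, derivation_eq_zero_of_mem_span h (B.mem_span i a ha),
      sub_zero, ← map_sub linForm] at this

end FiberedBasis

end HypArrangement

/-! ### Triangular bases and comparison of two bases -/

section Bases

open Module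

variable {R M : Type*} [CommRing R] [AddCommGroup M] [Module R M]

/-- Triangular criterion for a family to be a basis, in terms of functionals `φ i`. -/
lemma exists_basis_of_triangular [IsDomain R] {ι : Type*} [Fintype ι] (level : ι → ℕ)
    (hlevel : Function.Injective level) (v : ι → M) (φ : ι → M →ₗ[R] R)
    (hlow : ∀ i j, level j < level i → φ j (v i) = 0) (hdiag : ∀ i, φ i (v i) ≠ 0)
    (hdvd : ∀ m i, (∀ j, level j < level i → φ j m = 0) → φ i (v i) ∣ φ i m)
    (hφ : ∀ m, (∀ i, φ i m = 0) → m = 0) :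
    ∃ b : Basis ι R M, ∀ i, b i = v i := by
  have hli : LinearIndependent R v := by
    refine Fintype.linearIndependent_iff.2 fun g hg => ?_
    have key : ∀ N i, level i = N → g i = 0 := by
      intro N
      induction N using Nat.strong_induction_on with
      | _ N ih =>
        rintro i rfl
        have h1 := congrArg (φ i) hg
        rw [map_sum, map_zero, Finset.sum_eq_single i, map_smul, smul_eq_mul] at h1
        · exact (mul_eq_zero.1 h1).resolve_right (hdiag i)
        · intro j _ hj
          rw [map_smul, smul_eq_mul]
          rcases lt_trichotomy (level j) (level i) with h | h | h
          · rw [ih _ h j rfl, zero_mul]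
          · exact absurd (hlevel h) hj
          · rw [hlow j i h, mul_zero]
        · simp
    exact fun i => key _ i rfl
  have hspan : ⊤ ≤ Submodule.span R (Set.range v) := by
    obtain ⟨N, hN⟩ := (Set.finite_range level).bddAbove
    -- Induction on the number `k` of top levels at which `m` may have nonzero values; subtracting a
    -- multiple of one `v i` clears the lowest of them.
    have key : ∀ k m, (∀ j, level j + k < N + 1 → φ j m = 0) →
        m ∈ Submodule.span R (Set.range v) := by
      intro k
      induction k with
      | zero =>
        intro m hm
        rw [hφ m fun j => hm j (Nat.lt_succ_of_le (hN ⟨j, rfl⟩))]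
        exact Submodule.zero_mem _
      | succ k ih =>
        intro m hm
        by_cases hi : ∃ i, level i + k = N
        · obtain ⟨i, hi⟩ := hi
          obtain ⟨c, hc⟩ := hdvd m i fun j hj => hm j (by omega)
          have hsub : m - c • v i ∈ Submodule.span R (Set.range v) := by
            refine ih _ fun j hj => ?_
            rw [map_sub, map_smul, smul_eq_mul]
            by_cases hji : j = i
            · rw [hji, hc]
              ring
            · have : level j ≠ level i := fun h => hji (hlevel h)
              rw [hm j (by omega), hlow i j (by omega), mul_zero, sub_zero]
          have := Submodule.add_mem _ hsub
            (Submodule.smul_mem _ c (Submodule.subset_span ⟨i, rfl⟩))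
          rwa [sub_add_cancel] at this
        · refine ih m fun j hj => hm j ?_
          have : level j + k ≠ N := fun h => hi ⟨j, h⟩
          omega
    exact fun m _ => key (N + 1) m fun j hj => by omega
  exact ⟨Basis.mk hli hspan, fun i => Basis.mk_apply hli hspan i⟩

variable {n : Type*} [Fintype n]

/-- The change-of-basis determinant is a unit, so its image in the field is nonzero, and so is some
term of its Leibniz expansion. -/
lemma Module.Basis.exists_perm_repr_ne_zero {K : Type*} [Field K] (b c : Basis n R M)
    (ε : R →+* K) : ∃ σ : Equiv.Perm n, ∀ j, ε (b.repr (c j) (σ j)) ≠ 0 := by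
  classical
  have hdet : (ε.mapMatrix (b.toMatrix c)).det ≠ 0 := by
    rw [← RingHom.map_det, ← Module.Basis.det_apply]
    exact ((b.isUnit_det c).map ε).ne_zero
  rw [Matrix.det_apply] at hdet
  obtain ⟨σ, -, hσ⟩ := Finset.exists_ne_zero_of_sum_ne_zero hdet
  refine ⟨σ, fun j h => hσ ?_⟩
  rw [Finset.prod_eq_zero (Finset.mem_univ j) (by simpa [Module.Basis.toMatrix_apply] using h),
    smul_zero]

/-- If a ring endomorphism scales the values of all functionals at the basis vectors and at `m`,
then it scales the coordinates of `m`. -/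
lemma Module.Basis.mul_repr_eq_of_scaling (b : Basis n R M) {κ : Type*} (φ : κ → M →ₗ[R] R)
    (hφ : ∀ m, (∀ k, φ k m = 0) → m = 0) (ρ : R →+* R) {t : n → R}
    (hb : ∀ i k, ρ (φ k (b i)) = t i * φ k (b i)) {m : M} {s : R}
    (hm : ∀ k, ρ (φ k m) = s * φ k m) (i : n) :
    s * b.repr m i = t i * ρ (b.repr m i) := by
  -- The functionals `φ k` jointly separate points, so the scaling identities assemble into a linear
  -- relation among the `b i`.
  have hsum : ∑ i, (s * b.repr m i - t i * ρ (b.repr m i)) • b i = 0 := by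
    refine hφ _ fun k => ?_
    have hφm : φ k m = ∑ i, b.repr m i * φ k (b i) := by
      conv_lhs => rw [← b.sum_repr m, map_sum]
      simp only [map_smul, smul_eq_mul]
    have h1 := hm k
    rw [hφm, map_sum, Finset.mul_sum] at h1
    simp only [map_sum, map_smul, smul_eq_mul, sub_mul, Finset.sum_sub_distrib]
    rw [sub_eq_zero]
    calc ∑ i, s * b.repr m i * φ k (b i) = ∑ i, s * (b.repr m i * φ k (b i)) := by
          simp only [mul_assoc]
      _ = ∑ i, ρ (b.repr m i * φ k (b i)) := h1.symm
      _ = ∑ i, t i * ρ (b.repr m i) * φ k (b i) := by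
          refine Finset.sum_congr rfl fun i _ => ?_
          rw [map_mul, hb]
          ring
  exact sub_eq_zero.1 (Fintype.linearIndependent_iff.1 b.linearIndependent _ hsum i)

end Bases

/-! ### Freeness and uniqueness of the exponents -/

namespace HypArrangement

variable {V : Type*} [AddCommGroup V] [Module ℂ V] {A : HypArrangement V}

/-- Evaluation of the derivations in `D(A)` at an element of the coordinate ring. -/
def evalDer (A : HypArrangement V) (f : CoordRing V) :
    A.derivations →ₗ[CoordRing V] CoordRing V where
  toFun θ := (θ : Derivation ℂ (CoordRing V) (CoordRing V)) f
  map_add' _ _ := rfl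
  map_smul' _ _ := rfl

/-- An arrangement with a fibered basis is free, and its exponents are the numbers of nodes. -/
theorem FiberedBasis.hasExponents [FiniteDimensional ℂ V] {ι : Type*} [Fintype ι]
    (B : A.FiberedBasis ι) :
    A.HasExponents (Finset.univ.val.map fun i => (B.nodes i).card) := by
  choose θ hθ hhom hlow hdiag using B.exists_triangular_derivation
  obtain ⟨b, hb⟩ := exists_basis_of_triangular B.level B.level_injective
    (fun i => (⟨θ i, hθ i⟩ : A.derivations)) (fun i => A.evalDer (linForm (B.x i)))
    hlow
    (fun i => (hdiag i).trans_ne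
      (Finset.prod_ne_zero_iff.2 fun _ ha => linForm_ne_zero (B.sub_node_ne_zero i ha)))
    (fun η i h => (hdiag i).symm ▸ B.prod_dvd_apply η.2 h)
    (fun η h => Subtype.ext (derivation_ext_basis B.x fun j => (h j).trans (by simp)))
  have hcard : Fintype.card ι = Module.finrank ℂ V := by
    rw [← Subspace.dual_finrank_eq, Module.finrank_eq_card_basis B.x]
  let e : ι ≃ Fin (Module.finrank ℂ V) := Fintype.equivFinOfCardEq hcard
  refine ⟨b.reindex e, fun i => (B.nodes (e.symm i)).card, fun i => ?_, ?_⟩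
  · rw [Module.Basis.reindex_apply, hb]
    exact hhom _
  · rw [← Finset.map_univ_equiv e, Finset.map_val, Multiset.map_map]
    simp

/-- The exponents of a free arrangement are uniquely determined. -/
theorem HasExponents.unique {e f : Multiset ℕ} (he : A.HasExponents e)
    (hf : A.HasExponents f) : e = f := by
  obtain ⟨b, d, hb, rfl⟩ := he
  obtain ⟨c, d', hc, rfl⟩ := hf
  let ε : CoordRing V →ₐ[ℂ] ℂ := SymmetricAlgebra.algebraMapInv
  -- The coefficient of `c j` along `b (σ j)` has nonzero constant term. Dilation by `2` gives `2 ^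
  -- d' j = 2 ^ d (σ j)` on that term, hence equal degrees.
  obtain ⟨σ, hσ⟩ := Module.Basis.exists_perm_repr_ne_zero (R := CoordRing V)
    (M := A.derivations) b c ε.toRingHom
  have hdeg : ∀ j, d (σ j) = d' j := by
    intro j
    have h1 := Module.Basis.mul_repr_eq_of_scaling (R := CoordRing V)
      (M := A.derivations) b (fun α => A.evalDer (linForm α))
      (fun η h => Subtype.ext (derivation_ext fun α => (h α).trans (by simp)))
      (dilation 2).toRingHom (t := fun i => algebraMap ℂ _ (2 ^ d i))
      (fun i α => (dilation_of_mem_homogeneousPart 2 (hb i α)).trans (Algebra.smul_def _ _))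
      (fun α => (dilation_of_mem_homogeneousPart 2 (hc j α)).trans (Algebra.smul_def _ _)) (σ j)
    have h2 := congrArg ε h1
    rw [map_mul, map_mul, AlgHom.commutes, AlgHom.commutes] at h2
    have h3 : ε (dilation 2 (b.repr (c j) (σ j))) = ε (b.repr (c j) (σ j)) :=
      algebraMapInv_dilation 2 _
    have h4 : (2 : ℂ) ^ d' j = 2 ^ d (σ j) :=
      mul_right_cancel₀ (hσ j) (h2.trans (congrArg _ h3))
    have h5 : 2 ^ d' j = 2 ^ d (σ j) := by exact_mod_cast h4
    exact (Nat.pow_right_injective le_rfl h5).symm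
  have hperm : Finset.univ.val.map d = Finset.univ.val.map (d ∘ σ) := by
    conv_lhs => rw [← Finset.map_univ_equiv σ, Finset.map_val, Multiset.map_map]
    rfl
  rw [hperm]
  exact Multiset.map_congr rfl fun j _ => hdeg j

end HypArrangement

namespace HypArrangement

/-! ### Fibered bases of products -/

section Product

variable {V₁ V₂ : Type*} [AddCommGroup V₁] [Module ℂ V₁] [AddCommGroup V₂] [Module ℂ V₂]

/-- Pullback of linear forms along the first projection. -/
def pullFst (V₁ V₂ : Type*) [AddCommGroup V₁] [Module ℂ V₁] [AddCommGroup V₂] [Module ℂ V₂] :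
    Module.Dual ℂ V₁ →ₗ[ℂ] Module.Dual ℂ (V₁ × V₂) :=
  (LinearMap.fst ℂ V₁ V₂).dualMap

/-- Pullback of linear forms along the second projection. -/
def pullSnd (V₁ V₂ : Type*) [AddCommGroup V₁] [Module ℂ V₁] [AddCommGroup V₂] [Module ℂ V₂] :
    Module.Dual ℂ V₂ →ₗ[ℂ] Module.Dual ℂ (V₁ × V₂) :=
  (LinearMap.snd ℂ V₁ V₂).dualMap

lemma pullFst_injective : Function.Injective (pullFst V₁ V₂) :=
  LinearMap.dualMap_injective_of_surjective LinearMap.fst_surjective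

lemma pullSnd_injective : Function.Injective (pullSnd V₁ V₂) :=
  LinearMap.dualMap_injective_of_surjective LinearMap.snd_surjective

lemma ker_pullFst (α : Module.Dual ℂ V₁) :
    LinearMap.ker (pullFst V₁ V₂ α) = (LinearMap.ker α).prod ⊤ := by
  ext v
  simp [pullFst]

lemma ker_pullSnd (α : Module.Dual ℂ V₂) :
    LinearMap.ker (pullSnd V₁ V₂ α) = (⊤ : Submodule ℂ V₁).prod (LinearMap.ker α) := by
  ext v
  simp [pullSnd]

lemma prod_top_mem_hyperplanes {A₁ : HypArrangement V₁} (A₂ : HypArrangement V₂)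
    {H : Submodule ℂ V₁} (hH : H ∈ A₁.hyperplanes) :
    H.prod ⊤ ∈ (A₁.prod A₂).hyperplanes :=
  Finset.mem_union_left _ (Finset.mem_image_of_mem _ hH)

lemma top_prod_mem_hyperplanes (A₁ : HypArrangement V₁) {A₂ : HypArrangement V₂}
    {H : Submodule ℂ V₂} (hH : H ∈ A₂.hyperplanes) :
    (⊤ : Submodule ℂ V₁).prod H ∈ (A₁.prod A₂).hyperplanes :=
  Finset.mem_union_right _ (Finset.mem_image_of_mem _ hH)

lemma mem_prod_hyperplanes {A₁ : HypArrangement V₁} {A₂ : HypArrangement V₂}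
    {H : Submodule ℂ (V₁ × V₂)} : H ∈ (A₁.prod A₂).hyperplanes ↔
      (∃ K ∈ A₁.hyperplanes, K.prod ⊤ = H) ∨ ∃ K ∈ A₂.hyperplanes, Submodule.prod ⊤ K = H := by
  classical
  simp [prod]

open Classical in
/-- The concatenation of two fibered bases is a fibered basis of the product arrangement. -/
noncomputable def FiberedBasis.prod {A₁ : HypArrangement V₁} {A₂ : HypArrangement V₂}
    {ι₁ ι₂ : Type*} [Fintype ι₁] (B₁ : A₁.FiberedBasis ι₁) (B₂ : A₂.FiberedBasis ι₂) :
    (A₁.prod A₂).FiberedBasis (ι₁ ⊕ ι₂) :=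
  have hx_inl : ∀ i, ((B₁.x.prod B₂.x).map (LinearMap.coprodEquiv ℂ)) (Sum.inl i) =
      pullFst V₁ V₂ (B₁.x i) := fun i => by
    ext v <;> simp [pullFst]
  have hx_inr : ∀ i, ((B₁.x.prod B₂.x).map (LinearMap.coprodEquiv ℂ)) (Sum.inr i) =
      pullSnd V₁ V₂ (B₂.x i) := fun i => by
    ext v <;> simp [pullSnd]
  have hlevel : ∀ i j, B₁.level i < Finset.univ.sup B₁.level + 1 + B₂.level j := fun i j => by
    have : B₁.level i ≤ Finset.univ.sup B₁.level := Finset.le_sup (Finset.mem_univ i)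
    omega
  { x := (B₁.x.prod B₂.x).map (LinearMap.coprodEquiv ℂ)
    -- The shift puts every level of the second factor strictly above those of the first, keeping
    -- levels injective.
    level := Sum.elim B₁.level fun j => Finset.univ.sup B₁.level + 1 + B₂.level j
    level_injective := by
      rintro (i | i) (j | j) h
      · exact congrArg _ (B₁.level_injective h)
      · exact absurd h (hlevel i j).ne
      · exact absurd h (hlevel j i).ne'
      · exact congrArg _ (B₂.level_injective (Nat.add_left_cancel h))
    nodes := Sum.elim (fun i => (B₁.nodes i).image (pullFst V₁ V₂))
      fun j => (B₂.nodes j).image (pullSnd V₁ V₂)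
    mem_span := by
      rintro (i | i) _ ha' <;> obtain ⟨a, ha, rfl⟩ := Finset.mem_image.1 ha'
      · have h1 := Submodule.mem_map_of_mem (f := pullFst V₁ V₂) (B₁.mem_span i a ha)
        rw [Submodule.map_span] at h1
        refine Submodule.span_mono ?_ h1
        rintro _ ⟨_, ⟨j, hj, rfl⟩, rfl⟩
        exact ⟨Sum.inl j, hj, hx_inl j⟩
      · have h1 := Submodule.mem_map_of_mem (f := pullSnd V₁ V₂) (B₂.mem_span i a ha)
        rw [Submodule.map_span] at h1
        refine Submodule.span_mono ?_ h1
        rintro _ ⟨_, ⟨j, hj, rfl⟩, rfl⟩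
        exact ⟨Sum.inr j, Nat.add_lt_add_left hj _, hx_inr j⟩
    ker_mem := by
      rintro (i | i) _ ha' <;> obtain ⟨a, ha, rfl⟩ := Finset.mem_image.1 ha'
      · rw [hx_inl, ← map_sub, ker_pullFst]
        exact prod_top_mem_hyperplanes _ (B₁.ker_mem i a ha)
      · rw [hx_inr, ← map_sub, ker_pullSnd]
        exact top_prod_mem_hyperplanes _ (B₂.ker_mem i a ha)
    exists_node := by
      intro H hH
      rcases mem_prod_hyperplanes.1 hH with ⟨K, hK, rfl⟩ | ⟨K, hK, rfl⟩
      · obtain ⟨i, a, ha, rfl⟩ := B₁.exists_node K hK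
        refine ⟨Sum.inl i, _, Finset.mem_image_of_mem _ ha, ?_⟩
        rw [hx_inl, ← map_sub, ker_pullFst]
      · obtain ⟨i, a, ha, rfl⟩ := B₂.exists_node K hK
        refine ⟨Sum.inr i, _, Finset.mem_image_of_mem _ ha, ?_⟩
        rw [hx_inr, ← map_sub, ker_pullSnd]
    exists_lower := by
      rintro (i | i) _ ha' _ hb' hab <;> obtain ⟨a, ha, rfl⟩ := Finset.mem_image.1 ha' <;>
        obtain ⟨b, hb, rfl⟩ := Finset.mem_image.1 hb'
      · obtain ⟨j, hj, c, hc, hk⟩ := B₁.exists_lower i a ha b hb fun h => hab (congrArg _ h)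
        refine ⟨Sum.inl j, hj, _, Finset.mem_image_of_mem _ hc, ?_⟩
        rw [hx_inl, ← map_sub, ← map_sub, ker_pullFst, ker_pullFst, hk]
      · obtain ⟨j, hj, c, hc, hk⟩ := B₂.exists_lower i a ha b hb fun h => hab (congrArg _ h)
        refine ⟨Sum.inr j, Nat.add_lt_add_left hj _, _, Finset.mem_image_of_mem _ hc, ?_⟩
        rw [hx_inr, ← map_sub, ← map_sub, ker_pullSnd, ker_pullSnd, hk] }

lemma FiberedBasis.map_card_nodes_prod {A₁ : HypArrangement V₁} {A₂ : HypArrangement V₂}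
    {ι₁ ι₂ : Type*} [Fintype ι₁] [Fintype ι₂] (B₁ : A₁.FiberedBasis ι₁)
    (B₂ : A₂.FiberedBasis ι₂) :
    (Finset.univ.val.map fun i => ((B₁.prod B₂).nodes i).card) =
      (Finset.univ.val.map fun i => (B₁.nodes i).card) +
        Finset.univ.val.map fun i => (B₂.nodes i).card := by
  classical
  change ((Finset.univ : Finset ι₁).disjSum (Finset.univ : Finset ι₂)).val.map _ = _
  rw [Finset.val_disjSum, Multiset.disjSum, Multiset.map_add, Multiset.map_map, Multiset.map_map]
  congr 1 <;> refine Multiset.map_congr rfl fun i _ => ?_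
  · exact Finset.card_image_of_injective _ pullFst_injective
  · exact Finset.card_image_of_injective _ pullSnd_injective

end Product

/-! ### From a modular chain to a fibered basis -/

section ModularChain

variable {V : Type*} [AddCommGroup V] [Module ℂ V]

/-- A maximal chain of modular elements of `L(A)`, indexed by the natural numbers up to the
rank. -/
structure IsModularChain (A : HypArrangement V) (X : ℕ → Submodule ℂ V) : Prop where
  zero : X 0 = ⊤
  last : X A.rank = A.center
  lt : ∀ i < A.rank, X (i + 1) < X i
  modular : ∀ i ≤ A.rank, A.IsModular (X i)

lemma isSupersolvable_iff {A : HypArrangement V} :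
    A.IsSupersolvable ↔ ∃ X, A.IsModularChain X := by
  constructor
  · rintro ⟨X, h0, hl, hX, hm⟩
    -- Indices past the rank wrap around; `IsModularChain` does not constrain them.
    refine ⟨fun i => X (Fin.ofNat _ i), h0, ?_, fun i hi => hX ?_, fun i _ => hm _⟩
    · rw [← hl]
      congr 1
      ext
      simp
    · simp [Fin.lt_def, Fin.ofNat, Nat.mod_eq_of_lt (Nat.lt_succ_of_lt hi),
        Nat.mod_eq_of_lt (Nat.succ_lt_succ hi)]
  · rintro ⟨X, h0, hl, hX, hm⟩
    exact ⟨fun i => X i, h0, hl, Fin.strictAnti_iff_succ_lt.2 fun i => hX i i.2,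
      fun i => hm i (Nat.lt_succ_iff.1 i.2)⟩

/-- A hyperplane that is an intersection of members of `A` lies in one of them, and inclusion of
hyperplanes is equality. -/
lemma ker_mem_hyperplanes_of_mem_lattice {A : HypArrangement V} {α : Module.Dual ℂ V}
    (hα : α ≠ 0) (h : LinearMap.ker α ∈ A.lattice) : LinearMap.ker α ∈ A.hyperplanes := by
  obtain ⟨B, hB, hk⟩ := h
  obtain ⟨K, hK⟩ : B.Nonempty := by
    rw [Finset.nonempty_iff_ne_empty]
    rintro rfl
    exact hα (LinearMap.ker_eq_top.1 hk)
  obtain ⟨β, hβ, rfl⟩ := A.exists_form K (hB hK)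
  obtain ⟨c, rfl⟩ := exists_smul_eq_of_ker_le (hk.trans_le (Finset.inf_le hK))
  have hc : c ≠ 0 := by
    rintro rfl
    simp at hβ
  rw [← LinearMap.ker_smul α c hc]
  exact hB hK

/-- If `X` is modular, then two hyperplanes that do not contain `X`, with forms that agree up to
a form `γ` vanishing on `X`, intersect in the hyperplane `ker γ` of `A`. -/
lemma IsModular.ker_sub_mem {A : HypArrangement V} {X : Submodule ℂ V} (hX : A.IsModular X)
    {α β : Module.Dual ℂ V} (hα : LinearMap.ker α ∈ A.hyperplanes)
    (hβ : LinearMap.ker β ∈ A.hyperplanes) (hne : α ≠ β) (hXα : ¬ X ≤ LinearMap.ker α)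
    (hXγ : X ≤ LinearMap.ker (α - β)) : LinearMap.ker (α - β) ∈ A.hyperplanes := by
  classical
  apply ker_mem_hyperplanes_of_mem_lattice (sub_ne_zero.2 hne)
  have hY : LinearMap.ker α ⊓ LinearMap.ker β ∈ A.lattice :=
    ⟨{LinearMap.ker α, LinearMap.ker β}, by
      intro K hK
      rcases Finset.mem_insert.1 hK with rfl | hK
      · exact hα
      · rwa [Finset.mem_singleton.1 hK], by simp⟩
  -- It remains to see that `ker (α - β)` is `X + (ker α ∩ ker β)`: subtracting a multiple of a
  -- vector of `X` outside `ker α` moves any `v` of the left side into both kernels.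
  convert hX.2 _ hY using 1
  refine le_antisymm (fun v hv => ?_) (sup_le hXγ fun v hv => ?_)
  · obtain ⟨y, hy, hyα⟩ := SetLike.not_le_iff_exists.1 hXα
    rw [LinearMap.mem_ker] at hyα
    have hyβ : α y = β y := sub_eq_zero.1 (hXγ hy)
    have hvβ : α v = β v := sub_eq_zero.1 hv
    rw [← add_sub_cancel ((α v / α y) • y) v]
    refine Submodule.add_mem_sup (X.smul_mem _ hy) ⟨?_, ?_⟩
    · simp [hyα]
    · change β _ = 0
      rw [map_sub, map_smul, ← hyβ, ← hvβ, smul_eq_mul, div_mul_cancel₀ _ hyα, sub_self]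
  · change α v - β v = 0
    rw [LinearMap.mem_ker.1 hv.1, LinearMap.mem_ker.1 hv.2, sub_self]

namespace IsModularChain

variable {A : HypArrangement V} {X : ℕ → Submodule ℂ V} (hX : A.IsModularChain X)
include hX

lemma exists_level {H : Submodule ℂ V} (hH : H ∈ A.hyperplanes) {i : ℕ} (hi : X i ≤ H) :
    ∃ j < i, X (j + 1) ≤ H ∧ ¬ X j ≤ H := by
  induction i with
  | zero =>
    obtain ⟨α, hα, rfl⟩ := A.exists_form H hH
    rw [hX.zero, top_le_iff] at hi
    exact absurd (LinearMap.ker_eq_top.1 hi) hα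
  | succ i ih =>
    by_cases h : X i ≤ H
    · obtain ⟨j, hj, h1⟩ := ih h
      exact ⟨j, hj.trans i.lt_succ_self, h1⟩
    · exact ⟨i, i.lt_succ_self, hi, h⟩

lemma dualAnnihilator_lt {i : ℕ} (hi : i < A.rank) :
    (X i).dualAnnihilator < (X (i + 1)).dualAnnihilator := by
  refine lt_of_le_of_ne (Submodule.dualAnnihilator_anti (hX.lt i hi).le) fun h => ?_
  exact (hX.lt i hi).ne (Subspace.dualAnnihilator_inj.1 h).symm

variable [FiniteDimensional ℂ V]

/-- Strict descent bounds the dimension above from `V` and below from the center; the number of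
steps equals the total codimension, so both bounds are attained. -/
lemma finrank_add {i : ℕ} (hi : i ≤ A.rank) :
    Module.finrank ℂ (X i) + i = Module.finrank ℂ V := by
  have hlow : ∀ i ≤ A.rank, Module.finrank ℂ (X i) + i ≤ Module.finrank ℂ V := by
    intro i
    induction i with
    | zero => exact fun _ => Submodule.finrank_le _
    | succ i ih =>
      intro hi
      have := Submodule.finrank_lt_finrank_of_lt (hX.lt i hi)
      have := ih (by omega)
      omega
  have hup : ∀ k ≤ A.rank, Module.finrank ℂ A.center + k ≤ Module.finrank ℂ (X (A.rank - k)) := by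
    intro k
    induction k with
    | zero => intro _; rw [Nat.sub_zero, hX.last, add_zero]
    | succ k ih =>
      intro hk
      have h1 := Submodule.finrank_lt_finrank_of_lt (hX.lt (A.rank - (k + 1)) (by omega))
      rw [show A.rank - (k + 1) + 1 = A.rank - k by omega] at h1
      have := ih (by omega)
      omega
  have h1 := hlow i hi
  have h2 := hup (A.rank - i) (Nat.sub_le _ _)
  rw [Nat.sub_sub_self hi] at h2
  have h3 : A.rank + Module.finrank ℂ A.center = Module.finrank ℂ V :=
    Submodule.finrank_quotient_add_finrank A.center
  omega

lemma finrank_dualAnnihilator {i : ℕ} (hi : i ≤ A.rank) :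
    Module.finrank ℂ (X i).dualAnnihilator = i := by
  have h1 := hX.finrank_add hi
  have h2 := Subspace.finrank_add_finrank_dualAnnihilator_eq (X i)
  omega

/-- A family of forms adapted to the chain, extended to a basis of the dual space. -/
lemma exists_adapted_basis :
    ∃ (s : Set (Module.Dual ℂ V)) (x : Module.Basis (Fin A.rank ⊕ s) ℂ (Module.Dual ℂ V)),
      (∀ i : Fin A.rank, x (Sum.inl i) ∉ (X i).dualAnnihilator) ∧
      (∀ i : Fin A.rank, (X (i + 1)).dualAnnihilator =
        (X i).dualAnnihilator ⊔ Submodule.span ℂ {x (Sum.inl i)}) ∧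
      ∀ i : Fin A.rank, (X i).dualAnnihilator ≤
        Submodule.span ℂ ((fun j => x (Sum.inl j)) '' {j | j < i}) := by
  classical
  have hex : ∀ i : Fin A.rank, ∃ y, y ∈ (X (i + 1)).dualAnnihilator ∧
      y ∉ (X i).dualAnnihilator := fun i => SetLike.exists_of_lt (hX.dualAnnihilator_lt i.2)
  choose y hy hy' using hex
  have hsucc : ∀ i : Fin A.rank, (X (i + 1)).dualAnnihilator =
      (X i).dualAnnihilator ⊔ Submodule.span ℂ {y i} := by
    intro i
    have hle : (X i).dualAnnihilator ⊔ Submodule.span ℂ {y i} ≤ (X (i + 1)).dualAnnihilator :=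
      sup_le (hX.dualAnnihilator_lt i.2).le ((Submodule.span_singleton_le_iff_mem _ _).2 (hy i))
    refine (Submodule.eq_of_le_of_finrank_le hle ?_).symm
    rw [hX.finrank_dualAnnihilator i.2]
    have hlt : (X i).dualAnnihilator < (X i).dualAnnihilator ⊔ Submodule.span ℂ {y i} := by
      refine lt_of_le_of_ne le_sup_left fun h => hy' i ?_
      rw [h]
      exact Submodule.mem_sup_right (Submodule.mem_span_singleton_self _)
    have := Submodule.finrank_lt_finrank_of_lt hlt
    rwa [hX.finrank_dualAnnihilator i.2.le] at this
  have hspan : ∀ k ≤ A.rank, (X k).dualAnnihilator ≤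
      Submodule.span ℂ (y '' {j | (j : ℕ) < k}) := by
    intro k
    induction k with
    | zero =>
      intro _
      rw [hX.zero, Submodule.dualAnnihilator_top]
      exact bot_le
    | succ k ih =>
      intro hk
      rw [hsucc ⟨k, hk⟩]
      refine sup_le ((ih (by omega)).trans (Submodule.span_mono (Set.image_mono ?_)))
        (Submodule.span_mono ?_)
      · intro j hj
        exact Nat.lt_succ_of_lt hj
      · rintro _ rfl
        exact ⟨⟨k, hk⟩, Nat.lt_succ_self k, rfl⟩
  -- There are `A.rank` forms, and their span contains the annihilator of the center, of dimension
  -- `A.rank`.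
  have hli : LinearIndependent ℂ y := by
    rw [linearIndependent_iff_card_le_finrank_span, Fintype.card_fin]
    conv_lhs => rw [← hX.finrank_dualAnnihilator le_rfl]
    exact Submodule.finrank_mono ((hspan _ le_rfl).trans
      (Submodule.span_mono (Set.image_subset_range _ _)))
  have hx : ∀ i, Module.Basis.sumExtend hli (Sum.inl i) = y i := by
    intro i
    simp only [Module.Basis.sumExtend, Module.Basis.reindex_apply, Module.Basis.extend_apply_self]
    exact congrArg Subtype.val (@Equiv.Set.sumDiffSubset_apply_inl _ _ _
      (hli.linearIndepOn_id.subset_extend (Set.subset_univ _)) (_)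
      (Equiv.ofInjective y hli.injective i))
  refine ⟨_, Module.Basis.sumExtend hli, fun i => ?_, fun i => ?_, fun i => ?_⟩
  · rw [hx]
    exact hy' i
  · rw [hx]
    exact hsucc i
  · simp only [hx]
    exact hspan i i.2.le

/-- A supersolvable arrangement has a fibered basis. -/
theorem exists_fiberedBasis :
    ∃ s : Set (Module.Dual ℂ V), Finite s ∧ Nonempty (A.FiberedBasis (Fin A.rank ⊕ s)) := by
  classical
  obtain ⟨s, x, hx, hsucc, hspan⟩ := hX.exists_adapted_basis
  have hfin : Finite (Fin A.rank ⊕ s) := Module.Finite.finite_basis x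
  have hs : Finite s := Finite.of_injective _ (Sum.inr_injective (α := Fin A.rank))
  have hnode : ∀ (i : Fin A.rank) (H : Submodule ℂ V), ∃ a : Module.Dual ℂ V,
      H ∈ A.hyperplanes → X (i + 1) ≤ H → ¬ X i ≤ H →
        a ∈ (X i).dualAnnihilator ∧ LinearMap.ker (x (Sum.inl i) - a) = H := by
    intro i H
    by_cases h : H ∈ A.hyperplanes ∧ X (i + 1) ≤ H ∧ ¬ X i ≤ H
    swap
    · exact ⟨0, fun h1 h2 h3 => absurd ⟨h1, h2, h3⟩ h⟩
    obtain ⟨hH, h1, h2⟩ := h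
    obtain ⟨α, hα, rfl⟩ := A.exists_form H hH
    have hmem : α ∈ (X (i + 1)).dualAnnihilator :=
      (Submodule.mem_dualAnnihilator _).2 fun w hw => h1 hw
    rw [hsucc i, Submodule.mem_sup] at hmem
    obtain ⟨w, hw, _, hu, rfl⟩ := hmem
    obtain ⟨u, rfl⟩ := Submodule.mem_span_singleton.1 hu
    have hu0 : u ≠ 0 := by
      rintro rfl
      rw [zero_smul, add_zero] at h2
      exact h2 fun v hv => (Submodule.mem_dualAnnihilator _).1 hw v hv
    refine ⟨-(u⁻¹ • w), fun _ _ _ => ⟨Submodule.neg_mem _ (Submodule.smul_mem _ _ hw), ?_⟩⟩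
    rw [← LinearMap.ker_smul _ u hu0, smul_sub, smul_neg, smul_inv_smul₀ hu0, sub_neg_eq_add,
      add_comm]
  choose a ha using hnode
  let nodes : Fin A.rank → Finset (Module.Dual ℂ V) := fun i =>
    (A.hyperplanes.filter fun H => X (i + 1) ≤ H ∧ ¬ X i ≤ H).image (a i)
  have hnodes : ∀ i, ∀ b ∈ nodes i, b ∈ (X i).dualAnnihilator ∧
      LinearMap.ker (x (Sum.inl i) - b) ∈ A.hyperplanes ∧
      ¬ X i ≤ LinearMap.ker (x (Sum.inl i) - b) := by
    intro i b hb
    obtain ⟨H, hH, rfl⟩ := Finset.mem_image.1 hb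
    obtain ⟨hH, h1, h2⟩ := Finset.mem_filter.1 hH
    obtain ⟨h3, h4⟩ := ha i H hH h1 h2
    exact ⟨h3, by rwa [h4], by rwa [h4]⟩
  have hex : ∀ H ∈ A.hyperplanes, ∀ i ≤ A.rank, X i ≤ H →
      ∃ j : Fin A.rank, (j : ℕ) < i ∧ ∃ b ∈ nodes j, LinearMap.ker (x (Sum.inl j) - b) = H := by
    intro H hH i hi hiH
    obtain ⟨j, hj, h1, h2⟩ := hX.exists_level hH hiH
    refine ⟨⟨j, by omega⟩, hj, _, Finset.mem_image_of_mem _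
      (Finset.mem_filter.2 ⟨hH, h1, h2⟩), (ha _ H hH h1 h2).2⟩
  have : Fintype s := Fintype.ofFinite s
  let f : s → ℕ := fun t => Fintype.equivFin s t
  have hf : Function.Injective f := fun t u h => (Fintype.equivFin s).injective (Fin.ext h)
  refine ⟨s, hs, ⟨{
    x := x
    level := Sum.elim (fun i => (i : ℕ)) fun t => A.rank + f t
    level_injective := ?_
    -- The coordinates completing the basis carry no hyperplane and contribute exponents `0`.
    nodes := Sum.elim nodes fun _ => ∅
    mem_span := ?_
    ker_mem := ?_
    exists_node := ?_
    exists_lower := ?_ }⟩⟩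
  · rintro (i | i) (j | j) h
    · exact congrArg _ (Fin.ext h)
    · have h' : (i : ℕ) = A.rank + f j := h
      omega
    · have h' : A.rank + f i = (j : ℕ) := h
      omega
    · exact congrArg _ (hf (Nat.add_left_cancel h))
  · rintro (i | i) b hb
    · refine Submodule.span_mono ?_ (hspan i (hnodes i b hb).1)
      rintro _ ⟨j, hj, rfl⟩
      exact ⟨Sum.inl j, hj, rfl⟩
    · exact absurd hb (Finset.notMem_empty b)
  · rintro (i | i) b hb
    · exact (hnodes i b hb).2.1
    · exact absurd hb (Finset.notMem_empty b)
  · intro H hH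
    obtain ⟨j, -, h⟩ := hex H hH A.rank le_rfl (hX.last.trans_le (Finset.inf_le hH))
    exact ⟨Sum.inl j, h⟩
  · rintro (i | i) b hb c hc hbc
    · obtain ⟨hb1, hb2, hb3⟩ := hnodes i b hb
      obtain ⟨hc1, hc2, hc3⟩ := hnodes i c hc
      have hdiff : x (Sum.inl i) - c - (x (Sum.inl i) - b) = b - c := by abel
      have hle : X i ≤ LinearMap.ker (b - c) := fun v hv =>
        (Submodule.mem_dualAnnihilator _).1 (Submodule.sub_mem _ hb1 hc1) v hv
      -- Modularity of `X i` enters here; the resulting hyperplane contains `X i`, so it has level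
      -- below `i`.
      have hmem : LinearMap.ker (b - c) ∈ A.hyperplanes := by
        have := (hX.modular i i.2.le).ker_sub_mem hc2 hb2
          (fun h => hbc (sub_right_injective h).symm) hc3 (by rwa [hdiff])
        rwa [hdiff] at this
      obtain ⟨j, hj, h⟩ := hex _ hmem i i.2.le hle
      exact ⟨Sum.inl j, hj, h⟩
    · exact absurd hb (Finset.notMem_empty b)

end IsModularChain

end ModularChain

end HypArrangement

namespace HypArrangement

/-! ### Generalities on the intersection lattice -/

section Lattice

variable {V : Type*} [AddCommGroup V] [Module ℂ V] {A : HypArrangement V}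

lemma top_mem_lattice : ⊤ ∈ A.lattice := ⟨∅, by simp, by simp⟩

lemma mem_lattice_of_mem_hyperplanes {H : Submodule ℂ V} (hH : H ∈ A.hyperplanes) :
    H ∈ A.lattice := ⟨{H}, by simpa using hH, by simp⟩

lemma center_mem_lattice : A.center ∈ A.lattice := ⟨_, subset_rfl, rfl⟩

lemma inf_mem_lattice {X Y : Submodule ℂ V} (hX : X ∈ A.lattice) (hY : Y ∈ A.lattice) :
    X ⊓ Y ∈ A.lattice := by
  classical
  obtain ⟨B, hB, rfl⟩ := hX
  obtain ⟨C, hC, rfl⟩ := hY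
  exact ⟨B ∪ C, Finset.union_subset hB hC, Finset.inf_union.symm⟩

lemma lattice_induction {P : Submodule ℂ V → Prop} (htop : P ⊤)
    (hinf : ∀ H ∈ A.hyperplanes, ∀ X, P X → P (H ⊓ X)) {X : Submodule ℂ V}
    (hX : X ∈ A.lattice) : P X := by
  classical
  obtain ⟨B, hB, rfl⟩ := hX
  induction B using Finset.induction_on with
  | empty => exact htop
  | insert H B _ ih =>
    rw [Finset.inf_insert]
    exact hinf H (hB (Finset.mem_insert_self _ _)) _
      (ih fun K hK => hB (Finset.mem_insert_of_mem hK))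

lemma center_le_of_mem_lattice {X : Submodule ℂ V} (hX : X ∈ A.lattice) : A.center ≤ X :=
  lattice_induction le_top (fun _ hH _ h => le_inf (Finset.inf_le hH) h) hX

lemma isModular_top : A.IsModular ⊤ :=
  ⟨top_mem_lattice, fun Y _ => by rw [top_sup_eq]; exact top_mem_lattice⟩

lemma isModular_center : A.IsModular A.center :=
  ⟨center_mem_lattice, fun Y hY => by rwa [sup_eq_right.2 (center_le_of_mem_lattice hY)]⟩

end Lattice

/-! ### Lattice, modular elements and chains of a product -/

section ProductLattice

variable {V₁ V₂ : Type*} [AddCommGroup V₁] [Module ℂ V₁] [AddCommGroup V₂] [Module ℂ V₂]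
  {A₁ : HypArrangement V₁} {A₂ : HypArrangement V₂}

lemma submodule_prod_inj {X₁ Y₁ : Submodule ℂ V₁} {X₂ Y₂ : Submodule ℂ V₂}
    (h : X₁.prod X₂ = Y₁.prod Y₂) : X₁ = Y₁ ∧ X₂ = Y₂ := by
  constructor
  · rw [← Submodule.prod_map_fst X₁ X₂, h, Submodule.prod_map_fst]
  · rw [← Submodule.prod_map_snd X₁ X₂, h, Submodule.prod_map_snd]

lemma mem_prod_lattice {X : Submodule ℂ (V₁ × V₂)} : X ∈ (A₁.prod A₂).lattice ↔
    ∃ X₁ ∈ A₁.lattice, ∃ X₂ ∈ A₂.lattice, X₁.prod X₂ = X := by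
  constructor
  · refine lattice_induction (P := fun X => ∃ X₁ ∈ A₁.lattice, ∃ X₂ ∈ A₂.lattice, X₁.prod X₂ = X)
      ⟨⊤, top_mem_lattice, ⊤, top_mem_lattice, Submodule.prod_top⟩ ?_
    rintro H hH _ ⟨X₁, h₁, X₂, h₂, rfl⟩
    rcases mem_prod_hyperplanes.1 hH with ⟨K, hK, rfl⟩ | ⟨K, hK, rfl⟩
    · exact ⟨K ⊓ X₁, inf_mem_lattice (mem_lattice_of_mem_hyperplanes hK) h₁, X₂, h₂, by
        rw [Submodule.prod_inf_prod, top_inf_eq]⟩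
    · exact ⟨X₁, h₁, K ⊓ X₂, inf_mem_lattice (mem_lattice_of_mem_hyperplanes hK) h₂, by
        rw [Submodule.prod_inf_prod, top_inf_eq]⟩
  · rintro ⟨X₁, h₁, X₂, h₂, rfl⟩
    have key₁ : X₁.prod ⊤ ∈ (A₁.prod A₂).lattice := by
      refine lattice_induction (P := fun X => X.prod ⊤ ∈ (A₁.prod A₂).lattice) ?_ ?_ h₁
      · rw [Submodule.prod_top]
        exact top_mem_lattice
      · intro H hH X hX
        rw [← top_inf_eq (⊤ : Submodule ℂ V₂), ← Submodule.prod_inf_prod]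
        exact inf_mem_lattice (mem_lattice_of_mem_hyperplanes (prod_top_mem_hyperplanes _ hH)) hX
    have key₂ : Submodule.prod ⊤ X₂ ∈ (A₁.prod A₂).lattice := by
      refine lattice_induction (P := fun X => Submodule.prod ⊤ X ∈ (A₁.prod A₂).lattice) ?_ ?_ h₂
      · rw [Submodule.prod_top]
        exact top_mem_lattice
      · intro H hH X hX
        rw [← top_inf_eq (⊤ : Submodule ℂ V₁), ← Submodule.prod_inf_prod]
        exact inf_mem_lattice (mem_lattice_of_mem_hyperplanes (top_prod_mem_hyperplanes _ hH)) hX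
    have := inf_mem_lattice key₁ key₂
    rwa [Submodule.prod_inf_prod, inf_top_eq, top_inf_eq] at this

lemma prod_mem_lattice_iff {X₁ : Submodule ℂ V₁} {X₂ : Submodule ℂ V₂} :
    X₁.prod X₂ ∈ (A₁.prod A₂).lattice ↔ X₁ ∈ A₁.lattice ∧ X₂ ∈ A₂.lattice := by
  rw [mem_prod_lattice]
  constructor
  · rintro ⟨Y₁, h₁, Y₂, h₂, h⟩
    obtain ⟨rfl, rfl⟩ := submodule_prod_inj h
    exact ⟨h₁, h₂⟩
  · rintro ⟨h₁, h₂⟩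
    exact ⟨X₁, h₁, X₂, h₂, rfl⟩

/-- Sums of products are products of sums; pairing a test element with `⊤` isolates one factor. -/
lemma isModular_prod_iff {X₁ : Submodule ℂ V₁} {X₂ : Submodule ℂ V₂} :
    (A₁.prod A₂).IsModular (X₁.prod X₂) ↔ A₁.IsModular X₁ ∧ A₂.IsModular X₂ := by
  constructor
  · rintro ⟨h, hsup⟩
    obtain ⟨h₁, h₂⟩ := prod_mem_lattice_iff.1 h
    have key : ∀ Y₁ ∈ A₁.lattice, ∀ Y₂ ∈ A₂.lattice,
        X₁ ⊔ Y₁ ∈ A₁.lattice ∧ X₂ ⊔ Y₂ ∈ A₂.lattice := fun Y₁ hY₁ Y₂ hY₂ => by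
      have := hsup _ (prod_mem_lattice_iff.2 ⟨hY₁, hY₂⟩)
      rwa [Submodule.prod_sup_prod, prod_mem_lattice_iff] at this
    exact ⟨⟨h₁, fun Y hY => (key Y hY ⊤ top_mem_lattice).1⟩,
      ⟨h₂, fun Y hY => (key ⊤ top_mem_lattice Y hY).2⟩⟩
  · rintro ⟨⟨h₁, hs₁⟩, h₂, hs₂⟩
    refine ⟨prod_mem_lattice_iff.2 ⟨h₁, h₂⟩, fun Y hY => ?_⟩
    obtain ⟨Y₁, hY₁, Y₂, hY₂, rfl⟩ := mem_prod_lattice.1 hY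
    rw [Submodule.prod_sup_prod]
    exact prod_mem_lattice_iff.2 ⟨hs₁ _ hY₁, hs₂ _ hY₂⟩

lemma center_prod : (A₁.prod A₂).center = A₁.center.prod A₂.center := by
  apply le_antisymm
  · exact center_le_of_mem_lattice
      (prod_mem_lattice_iff.2 ⟨center_mem_lattice, center_mem_lattice⟩)
  · refine Finset.le_inf fun H hH => ?_
    rcases mem_prod_hyperplanes.1 hH with ⟨K, hK, rfl⟩ | ⟨K, hK, rfl⟩
    · exact Submodule.prod_mono (Finset.inf_le hK) le_top
    · exact Submodule.prod_mono le_top (Finset.inf_le hK)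

variable [FiniteDimensional ℂ V₁] [FiniteDimensional ℂ V₂]

lemma finrank_submodule_prod (X₁ : Submodule ℂ V₁) (X₂ : Submodule ℂ V₂) :
    Module.finrank ℂ (X₁.prod X₂) = Module.finrank ℂ X₁ + Module.finrank ℂ X₂ := by
  have h := LinearMap.finrank_range_of_inj (f := X₁.subtype.prodMap X₂.subtype)
    (Function.Injective.prodMap X₁.injective_subtype X₂.injective_subtype)
  rwa [LinearMap.range_prodMap, Submodule.range_subtype, Submodule.range_subtype,
    Module.finrank_prod] at h

lemma rank_prod : (A₁.prod A₂).rank = A₁.rank + A₂.rank := by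
  have h := Submodule.finrank_quotient_add_finrank (A₁.prod A₂).center
  have h₁ := Submodule.finrank_quotient_add_finrank A₁.center
  have h₂ := Submodule.finrank_quotient_add_finrank A₂.center
  rw [center_prod, finrank_submodule_prod, Module.finrank_prod, ← center_prod] at h
  unfold rank
  omega

/-- The chain descends in the first factor with the second kept whole, then in the second with the
first fixed at its center; the two descriptions agree at index `A₁.rank`. -/
lemma IsSupersolvable.prod (h₁ : A₁.IsSupersolvable) (h₂ : A₂.IsSupersolvable) :
    (A₁.prod A₂).IsSupersolvable := by
  obtain ⟨X, hX⟩ := isSupersolvable_iff.1 h₁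
  obtain ⟨Y, hY⟩ := isSupersolvable_iff.1 h₂
  let Z : ℕ → Submodule ℂ (V₁ × V₂) := fun i =>
    if i ≤ A₁.rank then (X i).prod ⊤ else A₁.center.prod (Y (i - A₁.rank))
  have hlow : ∀ i ≤ A₁.rank, Z i = (X i).prod ⊤ := fun i hi => if_pos hi
  have hup : ∀ i, A₁.rank ≤ i → Z i = A₁.center.prod (Y (i - A₁.rank)) := by
    intro i hi
    rcases hi.eq_or_lt with rfl | hi
    · rw [hlow _ le_rfl, hX.last, Nat.sub_self, hY.zero]
    · exact if_neg (not_le.2 hi)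
  refine isSupersolvable_iff.2 ⟨Z, ?_, ?_, fun i hi => ?_, fun i hi => ?_⟩
  · rw [hlow 0 (Nat.zero_le _), hX.zero, Submodule.prod_top]
  · rw [rank_prod, hup _ (Nat.le_add_right _ _), Nat.add_sub_cancel_left, hY.last, center_prod]
  · rw [rank_prod] at hi
    rcases lt_or_ge i A₁.rank with h | h
    · have hlt := hX.lt i h
      rw [hlow i h.le, hlow (i + 1) h]
      refine lt_of_le_of_ne (Submodule.prod_mono hlt.le le_rfl) fun h' => ?_
      exact hlt.ne (submodule_prod_inj h').1
    · have hlt := hY.lt (i - A₁.rank) (by omega)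
      rw [hup i h, hup (i + 1) (by omega), Nat.sub_add_comm h]
      refine lt_of_le_of_ne (Submodule.prod_mono le_rfl hlt.le) fun h' => ?_
      exact hlt.ne (submodule_prod_inj h').2
  · rw [rank_prod] at hi
    rcases le_total i A₁.rank with h | h
    · rw [hlow i h]
      exact isModular_prod_iff.2 ⟨hX.modular i h, isModular_top⟩
    · rw [hup i h]
      exact isModular_prod_iff.2 ⟨isModular_center, hY.modular _ (by omega)⟩

end ProductLattice

/-! ### Supersolvability of the factors -/

/-- A descending sequence of modular elements from `V` to the center in which the dimension drops
by at most one in each step contains a maximal chain. -/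
lemma isSupersolvable_of_steps {V : Type*} [AddCommGroup V] [Module ℂ V]
    [FiniteDimensional ℂ V] {A : HypArrangement V} {N : ℕ} {P : ℕ → Submodule ℂ V}
    (hzero : P 0 = ⊤) (hlast : P N = A.center) (hle : ∀ i < N, P (i + 1) ≤ P i)
    (hstep : ∀ i < N, Module.finrank ℂ (P i) ≤ Module.finrank ℂ (P (i + 1)) + 1)
    (hmod : ∀ i ≤ N, A.IsModular (P i)) : A.IsSupersolvable := by
  have hanti : ∀ j ≤ N, ∀ i ≤ j, P j ≤ P i := by
    intro j
    induction j with
    | zero =>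
      intro _ i hi
      rw [Nat.le_zero.1 hi]
    | succ j ih =>
      intro hj i hi
      rcases hi.eq_or_lt with rfl | hi
      · exact le_rfl
      · exact (hle j hj).trans (ih (by omega) i (by omega))
  have hrank : A.rank + Module.finrank ℂ A.center = Module.finrank ℂ V :=
    Submodule.finrank_quotient_add_finrank A.center
  -- Discrete intermediate value argument: drops of at most one skip no dimension.
  have hex : ∀ i ≤ N, ∀ j, Module.finrank ℂ (P i) + j ≤ Module.finrank ℂ V →
      ∃ k ≤ i, Module.finrank ℂ (P k) + j = Module.finrank ℂ V := by
    intro i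
    induction i with
    | zero =>
      intro _ j hj
      exact ⟨0, le_rfl, by rw [hzero, finrank_top] at hj ⊢; omega⟩
    | succ i ih =>
      intro hi j hj
      by_cases h : Module.finrank ℂ (P i) + j ≤ Module.finrank ℂ V
      · obtain ⟨k, hk, hkj⟩ := ih (by omega) j h
        exact ⟨k, by omega, hkj⟩
      · have := hstep i hi
        exact ⟨i + 1, le_rfl, by omega⟩
  have hex' : ∀ j, ∃ k ≤ N, j ≤ A.rank →
      Module.finrank ℂ (P k) + j = Module.finrank ℂ V := by
    intro j
    by_cases hj : j ≤ A.rank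
    · obtain ⟨k, hk, h⟩ := hex N le_rfl j (by rw [hlast]; omega)
      exact ⟨k, hk, fun _ => h⟩
    · exact ⟨0, Nat.zero_le _, fun h => absurd h hj⟩
  choose k hkN hk using hex'
  refine isSupersolvable_iff.2 ⟨fun j => P (k j), ?_, ?_, fun j hj => ?_,
    fun j _ => hmod _ (hkN j)⟩
  · exact Submodule.eq_top_of_finrank_eq (by simpa using hk 0 (Nat.zero_le _))
  · refine (Submodule.eq_of_le_of_finrank_le (hlast ▸ hanti N le_rfl _ (hkN _)) ?_).symm
    have := hk A.rank le_rfl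
    omega
  · have h1 := hk j hj.le
    have h2 := hk (j + 1) hj
    refine lt_of_le_of_ne ?_ fun h => ?_
    · rcases le_total (k j) (k (j + 1)) with h | h
      · exact hanti _ (hkN _) _ h
      · have := Submodule.finrank_mono (hanti _ (hkN _) _ h)
        omega
    · have h' : P (k (j + 1)) = P (k j) := h
      rw [h'] at h2
      omega

/-- For the forward direction, the component dimensions sum to a quantity dropping by one per step
and neither component grows, so both projected sequences satisfy `isSupersolvable_of_steps`. -/
theorem isSupersolvable_prod_iff {V₁ V₂ : Type*} [AddCommGroup V₁] [Module ℂ V₁]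
    [AddCommGroup V₂] [Module ℂ V₂] {A₁ : HypArrangement V₁} {A₂ : HypArrangement V₂}
    [FiniteDimensional ℂ V₁] [FiniteDimensional ℂ V₂] :
    (A₁.prod A₂).IsSupersolvable ↔ A₁.IsSupersolvable ∧ A₂.IsSupersolvable := by
  refine ⟨fun h => ?_, fun h => h.1.prod h.2⟩
  obtain ⟨Z, hZ⟩ := isSupersolvable_iff.1 h
  set r := (A₁.prod A₂).rank with hr
  have hdec : ∀ i, ∃ X : Submodule ℂ V₁ × Submodule ℂ V₂, i ≤ r → X.1.prod X.2 = Z i := by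
    intro i
    by_cases hi : i ≤ r
    · obtain ⟨X₁, -, X₂, -, h⟩ := mem_prod_lattice.1 (hZ.modular i hi).1
      exact ⟨(X₁, X₂), fun _ => h⟩
    · exact ⟨(⊤, ⊤), fun h => absurd h hi⟩
  choose X hXZ using hdec
  have hmod : ∀ i ≤ r, A₁.IsModular (X i).1 ∧ A₂.IsModular (X i).2 := fun i hi =>
    isModular_prod_iff.1 ((hXZ i hi).symm ▸ hZ.modular i hi)
  have hzero : (X 0).1 = ⊤ ∧ (X 0).2 = ⊤ := by
    apply submodule_prod_inj
    rw [hXZ 0 (Nat.zero_le _), hZ.zero, Submodule.prod_top]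
  have hlast : (X r).1 = A₁.center ∧ (X r).2 = A₂.center := by
    apply submodule_prod_inj
    rw [hXZ r le_rfl, hZ.last, center_prod]
  have hle : ∀ i < r, (X (i + 1)).1 ≤ (X i).1 ∧ (X (i + 1)).2 ≤ (X i).2 := by
    intro i hi
    have h1 := (hZ.lt i hi).le
    rw [← hXZ i hi.le, ← hXZ (i + 1) hi] at h1
    constructor
    · have := Submodule.map_mono (f := LinearMap.fst ℂ V₁ V₂) h1
      rwa [Submodule.prod_map_fst, Submodule.prod_map_fst] at this
    · have := Submodule.map_mono (f := LinearMap.snd ℂ V₁ V₂) h1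
      rwa [Submodule.prod_map_snd, Submodule.prod_map_snd] at this
  have hstep : ∀ i < r,
      Module.finrank ℂ (X i).1 ≤ Module.finrank ℂ (X (i + 1)).1 + 1 ∧
      Module.finrank ℂ (X i).2 ≤ Module.finrank ℂ (X (i + 1)).2 + 1 := by
    intro i hi
    have h1 := hZ.finrank_add hi.le
    have h2 := hZ.finrank_add (i := i + 1) hi
    rw [← hXZ _ hi.le, finrank_submodule_prod] at h1
    rw [← hXZ (i + 1) hi, finrank_submodule_prod] at h2
    have h3 := Submodule.finrank_mono (hle i hi).1
    have h4 := Submodule.finrank_mono (hle i hi).2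
    omega
  exact ⟨isSupersolvable_of_steps (P := fun i => (X i).1) hzero.1 hlast.1
      (fun i hi => (hle i hi).1) (fun i hi => (hstep i hi).1) fun i hi => (hmod i hi).1,
    isSupersolvable_of_steps (P := fun i => (X i).2) hzero.2 hlast.2
      (fun i hi => (hle i hi).2) (fun i hi => (hstep i hi).2) fun i hi => (hmod i hi).2⟩

end HypArrangement

theorem proposition2p5 {V₁ V₂ : Type*}
    [AddCommGroup V₁] [Module ℂ V₁] [FiniteDimensional ℂ V₁]
    [AddCommGroup V₂] [Module ℂ V₂] [FiniteDimensional ℂ V₂]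
    (A₁ : HypArrangement V₁) (A₂ : HypArrangement V₂) :
    ((A₁.prod A₂).IsSupersolvable ↔ A₁.IsSupersolvable ∧ A₂.IsSupersolvable) ∧
      ((A₁.prod A₂).IsSupersolvable →
        ∃ e₁ e₂ : Multiset ℕ,
          (∀ e, A₁.HasExponents e ↔ e = e₁) ∧
          (∀ e, A₂.HasExponents e ↔ e = e₂) ∧
          (∀ e, (A₁.prod A₂).HasExponents e ↔ e = e₁ + e₂)) := by
  refine ⟨HypArrangement.isSupersolvable_prod_iff, fun h => ?_⟩
  obtain ⟨h₁, h₂⟩ := HypArrangement.isSupersolvable_prod_iff.1 h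
  obtain ⟨X, hX⟩ := HypArrangement.isSupersolvable_iff.1 h₁
  obtain ⟨Y, hY⟩ := HypArrangement.isSupersolvable_iff.1 h₂
  obtain ⟨s, hs, ⟨B₁⟩⟩ := hX.exists_fiberedBasis
  obtain ⟨t, ht, ⟨B₂⟩⟩ := hY.exists_fiberedBasis
  have := Fintype.ofFinite s
  have := Fintype.ofFinite t
  have hprod := (B₁.prod B₂).hasExponents
  rw [HypArrangement.FiberedBasis.map_card_nodes_prod] at hprod
  exact ⟨_, _, fun e => ⟨fun he => he.unique B₁.hasExponents, fun he => he ▸ B₁.hasExponents⟩,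
    fun e => ⟨fun he => he.unique B₂.hasExponents, fun he => he ▸ B₂.hasExponents⟩,
    fun e => ⟨fun he => he.unique hprod, fun he => he ▸ hprod⟩⟩
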